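/- **Lattice.** Consider the honeycomb lattice with bond length $1$ and the triangular lattice of the centres of its hexagonal plaquettes. Let $\mathbf u_i=(\cos\theta_i,\sin\theta_i)$, $\mathbf u_i^\perp=(-\sin\theta_i,\cos\theta_i)$ with $\theta_i=\frac{\pi}{3}(i-1)$, and $\mathbf w_i=\sqrt3(\cos\phi_i,\sin\phi_i)$ with $\phi_i=\frac{\pi}{6}(2i-1)$, $i=1,\dots,6$; let $\mathbf v_1=(1,0)$, $\mathbf v_{2}=(-\frac12,\frac{\sqrt3}2)$, $\mathbf v_3=(-\frac12,-\frac{\sqrt3}2)$ be the vectors from a vertex of honeycomb sublattice $A$ to its neighbours. Let $\Lambda=\Lambda_p\sqcup\Lambda_f$ be a finite lattice, where $\Lambda_f$ is a finite set of plaquette centres and $\Lambda_p$ a finite set of honeycomb vertices with $\mathbf R+\mathbf u_i\in\Lambda_p$ for all $\mathbf R\in\Lambda_f$ and all $i$. Points may be identified modulo a group of translations of the honeycomb lattice that contains none of the $\mathbf w_i$; in particular periodic boundary conditions are allowed. Terms below that involve sites outside $\Lambda$ are omitted. **Hamiltonian.** Spin-$\frac12$ electrons occupy one $f$ orbital on each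 site of $\Lambda_f$ (operators $f_{\mathbf R,\sigma}$) and orbitals $p_x,p_y$ on each site of $\Lambda_p$ (operators $\vec p_{\mathbf r,\sigma}$; $p_{\mathbf r,\mathbf e,\sigma}=\mathbf e\cdot\vec p_{\mathbf r,\sigma}$). Let $c_\sigma(o)$ be the annihilation operator of spin $\sigma$ in the orbital $o$, and let $n_{o,\sigma}=c^\dagger_\sigma(o)c_\sigma(o)$, $n_o=n_{o,\uparrow}+n_{o,\downarrow}$, $\vec S_o=\frac12\sum_{\mu\nu}c_\mu^\dagger(o)\vec\sigma_{\mu\nu}c_\nu(o)$. Let $N_p$, $N_f$ be the numbers of electrons in $p$ and $f$ orbitals. With real parameters $t_p,t_f,t_{fp},U_p,U_f,J>0$ and $\mu_p,\mu_f\in\mathbb R$ put $$H_K=t_p\sum_{\mathbf r\in\Lambda_p^A,\sigma}\sum_{i=1}^3\big(p^\dagger_{\mathbf r+\mathbf v_i,\mathbf v_i,\sigma}p_{\mathbf r,\mathbf v_i,\sigma}+h.c.\big)+t_f\sum_{\mathbf R\in\Lambda_f,\sigma}\sum_{i=1}^6f^\dagger_{\mathbf R+\mathbf w_i,\sigma}f_{\mathbf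 R,\sigma}+t_{fp}\sum_{\mathbf R\in\Lambda_f,\sigma}\sum_{i=1}^6(-1)^{i-1}\big(f^\dagger_{\mathbf R,\sigma}p_{\mathbf R+\mathbf u_i,\mathbf u_i^\perp,\sigma}+h.c.\big),$$ $$H_U=\sum_{o}U_o\big(n_{o,\uparrow}-\tfrac12\big)\big(n_{o,\downarrow}-\tfrac12\big),\qquad H_J=-J\sum_{\mathbf r\in\Lambda_p}\big(\vec S_{\mathbf r,p_x}\cdot\vec S_{\mathbf r,p_y}-\tfrac14n_{\mathbf r,p_x}n_{\mathbf r,p_y}\big),\qquad H_\mu=-\mu_pN_p-\mu_fN_f,$$ where $U_o=U_p$ for $p$ orbitals and $U_o=U_f$ for $f$ orbitals, and let $$H^{(ph)}=-H_K+H_U+H_J-\tfrac J2N_p-H_\mu .$$ **Localized states and clusters.** For $\mathbf R\in\Lambda_f$ let $\varphi_{\mathbf R}$ be the normalized one-particle wavefunction proportional to $t_{fp}$ on the $f$ orbital at $\mathbf R$, to $(-1)^{i-1}t_f\,\mathbf u_i^\perp$ on the $p$ orbitals at $\mathbf R+\mathbf u_i$ ($i=1,\dots,6$), and $0$ elsewhere;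 let $a^\dagger_{\mathbf R,\sigma}=\sum_o\varphi_{\mathbf R}(o)\,c^\dagger_\sigma(o)$. Two labels $\mathbf R,\mathbf R'$ overlap if $\varphi_{\mathbf R}$ and $\varphi_{\mathbf R'}$ are both nonzero at some orbital. The clusters $C_1,\dots,C_n$ of a set $A\subset\Lambda_f$ are its connected components under overlap, and $S^-_{C_k}=\sum_oc^\dagger_\downarrow(o)c_\uparrow(o)$, summed over the orbitals $o$ at which some $\varphi_{\mathbf R}$, $\mathbf R\in C_k$, is nonzero. **Theorem.** Suppose $t_{fp}^2>3t_pt_f$ and $$\mu_f=\mu_f^c+\frac{U_f}2-\frac{U_p}2-\frac J2,\qquad \mu_f^c=\mu_p+6t_f+\frac32t_p-\frac{t_{fp}^2}{t_f}.$$ Then for every $N_e\le|\Lambda_f|$ the $N_e$-electron ground-state space of $H^{(ph)}$ is spanned by the states $$\prod_{k=1}^n\big(S^-_{C_k}\big)^{\frac{|C_k|}2-m_k}\prod_{\mathbf R\in A}a^\dagger_{\mathbf R,\uparrow}|0\rangle,$$ where $A\subset\Lambda_f$ runs over the sets with $|A|=N_e$, $C_1,\dots,C_n$ are the clusters of $A$,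 and $m_k\in\{-\frac{|C_k|}2,-\frac{|C_k|}2+1,\dots,\frac{|C_k|}2\}$. -/

import Mathlib

noncomputable section

namespace FlatBand

/-! ## Fermionic Fock space over a finite set of modes -/

/-- The fermionic Fock space over the modes `M`, in the occupation number basis: the basis vector
labelled by `S` is the state in which exactly the modes in `S` are occupied. -/
abbrev Fock (M : Type*) [Fintype M] := EuclideanSpace ℂ (Finset M)

/-- Linear operators on Fock space. -/
abbrev Op (M : Type*) [Fintype M] := Module.End ℂ (Fock M)

section Fock

variable {M : Type*} [Fintype M]

open Classical in
/-- The Jordan-Wigner sign: `(-1)` to the number of occupied modes that precede `x` in a fixed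
enumeration of the modes. -/
def jwSign (x : M) (S : Finset M) : ℂ :=
  (-1) ^ (S.filter (fun y => Fintype.equivFin M y < Fintype.equivFin M x)).card

open Classical in
/-- The annihilation operator of the mode `x`. It sends the basis vector `S` to
`± (S without x)` if `x ∈ S`, and to `0` otherwise. -/
def ann (x : M) : Op M where
  toFun ψ := WithLp.toLp 2 (fun S => if x ∈ S then 0 else jwSign x S * ψ (insert x S))
  map_add' ψ χ := by
    ext S
    by_cases h : x ∈ S <;> simp [h, mul_add]
  map_smul' a ψ := by
    ext S
    by_cases h : x ∈ S <;> simp [h, mul_left_comm]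

/-- The Hermitian adjoint of an operator. -/
def dag (T : Op M) : Op M := LinearMap.adjoint T

open Classical in
/-- The vacuum: no mode is occupied. -/
def vacuum : Fock M := EuclideanSpace.single (∅ : Finset M) (1 : ℂ)

/-- The space of states with exactly `N` particles. -/
def sector (N : ℕ) : Submodule ℂ (Fock M) where
  carrier := {ψ | ∀ S : Finset M, S.card ≠ N → ψ S = 0}
  add_mem' := by
    intro ψ χ hψ hχ S hS
    simp [hψ S hS, hχ S hS]
  zero_mem' := by
    intro S _
    simp
  smul_mem' := by
    intro a ψ hψ S hS
    simp [hψ S hS]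

/-- `V` is the `N`-particle ground state space of `H`: there is a lowest energy `E` among the
energies of the `N`-particle eigenstates of `H`, and `V` consists of all `N`-particle states `ψ`
with `H ψ = E ψ`. -/
def IsGroundStateSpace (H : Op M) (N : ℕ) (V : Submodule ℂ (Fock M)) : Prop :=
  ∃ E : ℝ,
    IsLeast {e : ℝ | ∃ ψ ∈ sector (M := M) N, ψ ≠ 0 ∧ H ψ = (e : ℂ) • ψ} E ∧
    ∀ ψ : Fock M, ψ ∈ V ↔ ψ ∈ sector (M := M) N ∧ H ψ = (E : ℂ) • ψ

end Fock

/-! ## The two-layer lattice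

The plaquette centres and the vertices of the honeycomb lattice with bond length `1` together form
the triangular lattice with spacing `1`. The pair `(m, n) : ℤ × ℤ` stands for the point
`m u₁ + n u₂` of the plane, with `u₁ = (1, 0)` and `u₂ = (1/2, √3/2)`. The plaquette centres are
the points with `m - n ≡ 0 (mod 3)`, the points with `m - n ≡ 1` form the honeycomb sublattice `A`,
and those with `m - n ≡ 2` the sublattice `B`. -/

/-- `m - n (mod 3)`. -/
def colour : ℤ × ℤ →+ ZMod 3 :=
  (Int.castAddHom (ZMod 3)).comp (AddMonoidHom.fst ℤ ℤ - AddMonoidHom.snd ℤ ℤ)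

/-- The vectors `uᵢ = (cos θᵢ, sin θᵢ)`, `θᵢ = i π / 3`, `i = 0, …, 5`, from the centre of a
plaquette to its corners, in the coordinates `(m, n)`. -/
def uVec : Fin 6 → ℤ × ℤ := ![(1, 0), (0, 1), (-1, 1), (-1, 0), (0, -1), (1, -1)]

/-- The six nearest-neighbour vectors of the triangular lattice of plaquette centres,
`√3 (cos φᵢ, sin φᵢ)` with `φᵢ = π / 6 + i π / 3`, in the coordinates `(m, n)`. -/
def wVec : Fin 6 → ℤ × ℤ := ![(1, 1), (-1, 2), (-2, 1), (-1, -1), (1, -2), (2, -1)]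

/-- The three vectors from a site of sublattice `A` to its nearest neighbours, which lie in the
sublattice `B`, in the coordinates `(m, n)`. -/
def vVec : Fin 3 → ℤ × ℤ := ![(1, 0), (-1, 1), (0, -1)]

/-- The Cartesian components of the bond directions `vVec`. -/
def vHat : Fin 3 → Fin 2 → ℝ :=
  ![![1, 0], ![-(1 / 2), Real.sqrt 3 / 2], ![-(1 / 2), -(Real.sqrt 3 / 2)]]

/-- The Cartesian components of `uᵢ^⊥ = (-sin θᵢ, cos θᵢ)`, with `θᵢ = i π / 3`. -/
def uPerp (i : Fin 6) : Fin 2 → ℝ :=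
  ![-Real.sin ((i : ℝ) * (Real.pi / 3)), Real.cos ((i : ℝ) * (Real.pi / 3))]

/-- A finite two-layer lattice `Λ = Λ_p ⊔ Λ_f`. Points of the plane are identified modulo a group
`Γ` of lattice translations; the finite sets of sites are otherwise arbitrary, except that the six
corners of each plaquette in `Λ_f` belong to `Λ_p`. With `Γ` of finite index and all sites
included this is the lattice with periodic boundary conditions, with `Γ` trivial it is a finite
piece of the plane. -/
structure TwoLayer where
  /-- The translations by which points are identified. -/
  Γ : AddSubgroup (ℤ × ℤ)
  /-- They preserve the plaquette centres and both sublattices. -/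
  Γ_colour : ∀ g ∈ Γ, colour g = 0
  /-- Adjacent plaquettes are not identified (so that a plaquette has six distinct corners). -/
  wVec_not_mem : ∀ i, wVec i ∉ Γ
  /-- The `f`-orbital sites. -/
  Λf : Finset ((ℤ × ℤ) ⧸ Γ)
  /-- The `p`-orbital sites. -/
  Λp : Finset ((ℤ × ℤ) ⧸ Γ)
  /-- The `f`-orbital sites are plaquette centres. -/
  colour_f : ∀ z : ℤ × ℤ, (z : (ℤ × ℤ) ⧸ Γ) ∈ Λf → colour z = 0
  /-- The `p`-orbital sites are vertices of the honeycomb lattice. -/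
  colour_p : ∀ z : ℤ × ℤ, (z : (ℤ × ℤ) ⧸ Γ) ∈ Λp → colour z ≠ 0
  /-- The corners of the plaquettes in `Λ_f` are in `Λ_p`. -/
  corner_mem : ∀ R ∈ Λf, ∀ i, R + (uVec i : (ℤ × ℤ) ⧸ Γ) ∈ Λp

/-- The real parameters of the model. -/
structure Couplings where
  tp : ℝ
  tf : ℝ
  tfp : ℝ
  Up : ℝ
  Uf : ℝ
  J : ℝ
  μp : ℝ
  μf : ℝ

namespace TwoLayer

variable (L : TwoLayer)

/-- Points of the plane lattice, modulo the identifications. -/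
abbrev Site := (ℤ × ℤ) ⧸ L.Γ

/-- The sublattice of a site. -/
def siteColour : L.Site →+ ZMod 3 := QuotientAddGroup.lift L.Γ colour L.Γ_colour

/-- The `A` sublattice of the `p`-orbital layer. -/
def ΛpA : Finset L.Site := L.Λp.filter (fun r => L.siteColour r = 1)

/-- The orbitals: one `f` orbital on each site of `Λ_f` (`Sum.inl`), and `p_x` and `p_y` orbitals
(components `0` and `1`) on each site of `Λ_p` (`Sum.inr`). -/
abbrev Orb := {R : L.Site // R ∈ L.Λf} ⊕ {r : L.Site // r ∈ L.Λp} × Fin 2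

/-- The single-particle modes: an orbital together with a spin, `0` for `↑` and `1` for `↓`. -/
abbrev Mode := L.Orb × Fin 2

/-- The annihilation operator of an electron of spin `σ` in the orbital `o`. -/
def c (σ : Fin 2) (o : L.Orb) : Op L.Mode := ann (o, σ)

open Classical in
/-- The operator `f_{R,σ}`. For a site outside `Λ_f` it is `0`: hopping terms that involve sites
outside of the lattice are omitted. -/
def f (R : L.Site) (σ : Fin 2) : Op L.Mode :=
  if h : R ∈ L.Λf then L.c σ (Sum.inl ⟨R, h⟩) else 0

open Classical in
/-- The Cartesian components of the vector operator `p_{r,σ}`, with the same convention. -/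
def p (r : L.Site) (d : Fin 2) (σ : Fin 2) : Op L.Mode :=
  if h : r ∈ L.Λp then L.c σ (Sum.inr (⟨r, h⟩, d)) else 0

/-- The projection `p_{r,e,σ} = e · p_{r,σ}` of the `p` orbitals at `r` in the direction `e`. -/
def pDir (r : L.Site) (e : Fin 2 → ℝ) (σ : Fin 2) : Op L.Mode :=
  ∑ d : Fin 2, (e d : ℂ) • L.p r d σ

/-- The number operator of an orbital and spin. -/
def num (o : L.Orb) (σ : Fin 2) : Op L.Mode := dag (L.c σ o) * L.c σ o

/-! ## The Hamiltonian -/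

/-- Hopping between `p` orbitals along the honeycomb bonds. -/
def hopP (K : Couplings) : Op L.Mode :=
  (K.tp : ℂ) • ∑ r ∈ L.ΛpA, ∑ σ : Fin 2, ∑ i : Fin 3,
    (dag (L.pDir (r + (vVec i : L.Site)) (vHat i) σ) * L.pDir r (vHat i) σ
      + dag (dag (L.pDir (r + (vVec i : L.Site)) (vHat i) σ) * L.pDir r (vHat i) σ))

/-- Hopping between `f` orbitals. Each bond occurs in both directions in the sum over the six
neighbours, so that the sum contains the Hermitian conjugate of each of its terms. -/
def hopF (K : Couplings) : Op L.Mode :=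
  (K.tf : ℂ) • ∑ R ∈ L.Λf, ∑ σ : Fin 2, ∑ i : Fin 6,
    dag (L.f (R + (wVec i : L.Site)) σ) * L.f R σ

/-- Hopping between the layers. -/
def hopFP (K : Couplings) : Op L.Mode :=
  (K.tfp : ℂ) • ∑ R ∈ L.Λf, ∑ σ : Fin 2, ∑ i : Fin 6, (-1 : ℂ) ^ (i : ℕ) •
    (dag (L.f R σ) * L.pDir (R + (uVec i : L.Site)) (uPerp i) σ
      + dag (dag (L.f R σ) * L.pDir (R + (uVec i : L.Site)) (uPerp i) σ))

/-- The kinetic Hamiltonian `H_K`. -/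
def HK (K : Couplings) : Op L.Mode := L.hopP K + L.hopF K + L.hopFP K

/-- The number of `p`-orbital electrons. -/
def Np : Op L.Mode :=
  ∑ r : {r : L.Site // r ∈ L.Λp}, ∑ d : Fin 2, ∑ σ : Fin 2, L.num (Sum.inr (r, d)) σ

/-- The number of `f`-orbital electrons. -/
def Nf : Op L.Mode :=
  ∑ R : {R : L.Site // R ∈ L.Λf}, ∑ σ : Fin 2, L.num (Sum.inl R) σ

/-- The chemical potential term `H_μ`. -/
def Hμ (K : Couplings) : Op L.Mode := -((K.μp : ℂ) • L.Np) - (K.μf : ℂ) • L.Nf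

/-- The particle-hole symmetric intra-orbital Hubbard interaction `H_U`. -/
def HU (K : Couplings) : Op L.Mode :=
  (K.Up : ℂ) • ∑ r : {r : L.Site // r ∈ L.Λp}, ∑ d : Fin 2,
      (L.num (Sum.inr (r, d)) 0 - (1 / 2 : ℂ) • (1 : Op L.Mode)) *
        (L.num (Sum.inr (r, d)) 1 - (1 / 2 : ℂ) • (1 : Op L.Mode))
    + (K.Uf : ℂ) • ∑ R : {R : L.Site // R ∈ L.Λf},
      (L.num (Sum.inl R) 0 - (1 / 2 : ℂ) • (1 : Op L.Mode)) *
        (L.num (Sum.inl R) 1 - (1 / 2 : ℂ) • (1 : Op L.Mode))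

/-- The Pauli matrices `σˣ, σʸ, σᶻ`. -/
def pauli : Fin 3 → Matrix (Fin 2) (Fin 2) ℂ :=
  ![!![0, 1; 1, 0], !![0, -Complex.I; Complex.I, 0], !![1, 0; 0, -1]]

/-- The `i`-th component of the spin of the orbital `o`. -/
def spin (o : L.Orb) (i : Fin 3) : Op L.Mode :=
  (1 / 2 : ℂ) • ∑ μ : Fin 2, ∑ ν : Fin 2, pauli i μ ν • (dag (L.c μ o) * L.c ν o)

/-- Hund's coupling `H_J` between the `p_x` and `p_y` orbitals of each site. -/
def HJ (K : Couplings) : Op L.Mode :=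
  -((K.J : ℂ) • ∑ r : {r : L.Site // r ∈ L.Λp},
    (∑ i : Fin 3, L.spin (Sum.inr (r, 0)) i * L.spin (Sum.inr (r, 1)) i
      - (1 / 4 : ℂ) • ((∑ σ : Fin 2, L.num (Sum.inr (r, 0)) σ) *
          ∑ σ : Fin 2, L.num (Sum.inr (r, 1)) σ)))

/-- The particle-hole transformed Hamiltonian `-H_K + H_U + H_J - (J/2) N_p - H_μ`. -/
def Hph (K : Couplings) : Op L.Mode :=
  -L.HK K + L.HU K + L.HJ K - ((K.J / 2 : ℝ) : ℂ) • L.Np - L.Hμ K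

/-! ## Localized states and clusters -/

/-- The index set `Λ_f` of the localized states, as a type. -/
abbrev Label := {R : L.Site // R ∈ L.Λf}

open Classical in
/-- The wavefunction of the normalized localized state centred at `R`: it is proportional to
`t_fp` on the `f` orbital at `R` and to `± t_f uᵢ^⊥`, with alternating signs, on the `p` orbitals at
the corners `R + uᵢ`. -/
def φ (K : Couplings) (R : L.Label) : L.Orb → ℝ
  | Sum.inl R' => if R' = R then K.tfp / Real.sqrt (6 * K.tf ^ 2 + K.tfp ^ 2) else 0
  | Sum.inr (r, d) => K.tf / Real.sqrt (6 * K.tf ^ 2 + K.tfp ^ 2) *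
      ∑ i : Fin 6, if R.1 + (uVec i : L.Site) = r.1 then (-1) ^ (i : ℕ) * uPerp i d else 0

/-- The creation operator `a†_{R,σ}` of an electron in the localized state at `R`. -/
def aDag (K : Couplings) (R : L.Label) (σ : Fin 2) : Op L.Mode :=
  ∑ o : L.Orb, (L.φ K R o : ℂ) • dag (L.c σ o)

/-- Two localized states overlap if they are both nonzero at some orbital. -/
def Overlap (K : Couplings) (R R' : L.Label) : Prop :=
  ∃ o : L.Orb, L.φ K R o ≠ 0 ∧ L.φ K R' o ≠ 0

open Classical in
/-- The cluster of `R` in `A`: the elements of `A` that can be reached from `R` by a path in `A`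
with overlapping consecutive states. -/
def cluster (K : Couplings) (A : Finset L.Label) (R : L.Label) : Finset L.Label :=
  A.filter (Relation.ReflTransGen (fun P P' => P' ∈ A ∧ L.Overlap K P P') R)

open Classical in
/-- The set of the clusters `C_k` of `A`. -/
def clusters (K : Couplings) (A : Finset L.Label) : Finset (Finset L.Label) :=
  A.image (L.cluster K A)

open Classical in
/-- The spin-lowering operator `S⁻_C`, the sum of `c†_↓ c_↑` over the orbitals at which at least
one localized state of `C` is nonzero. -/
def spinLower (K : Couplings) (C : Finset L.Label) : Op L.Mode :=
  ∑ o : L.Orb with ∃ R ∈ C, L.φ K R o ≠ 0, dag (L.c 1 o) * L.c 0 o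

/-- The state `∏_k (S⁻_{C_k})^{n(C_k)} ∏_{R ∈ A} a†_{R↑} |0⟩`, where `C_k` are the clusters of `A`.
The factors are taken in a fixed order, which is immaterial: the lowering operators commute, and
the creation operators anticommute. In terms of the magnetization `m_k` of the cluster `C_k`,
`n(C_k) = |C_k|/2 - m_k`. -/
def clusterState (K : Couplings) (A : Finset L.Label) (n : Finset L.Label → ℕ) : Fock L.Mode :=
  (((L.clusters K A).toList.map (fun C => L.spinLower K C ^ n C)).prod *
    (A.toList.map (fun R => L.aDag K R 0)).prod) vacuum

end TwoLayer

/-- The value `μ_f^c` at which `H_K + H_μ` has a flat band spanned by the localized states. -/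
def Couplings.μfc (K : Couplings) : ℝ := K.μp + 6 * K.tf + 3 / 2 * K.tp - K.tfp ^ 2 / K.tf

end FlatBand

end

/-!
On the `N`-particle states the Hamiltonian is a constant plus a nonnegative operator (`excess`), so
the ground states are the states in its kernel, once this kernel is seen to be nontrivial.

*One-body part.* The `p` parts of the localized states are annihilated by the bonding combination of
each honeycomb bond, and their Gram matrix is `6` minus the adjacency matrix of the plaquettes.
Hence the one-particle quadratic form is the flat-band energy plus
`t_fp² / t_f |Z|² - ⟨Z, D Z⟩`, where `Z` is the deviation of the `p` part of the wavefunction from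
that of the superposition of localized states with the same `f` part, and `0 ≤ D ≤ 3 t_p`
(`one_particle_identity`). For `t_fp² > 3 t_p t_f` its second quantization is a sum of squares whose
common kernel is that of the annihilators `dev` of the deviation.

*Interactions.* Up to terms proportional to the particle number, these are a sum of squares of the
operators that remove two electrons from one orbital, and of those that remove a singlet from the
`p_x` and `p_y` orbitals of a site. On a state in the flat band the `p` annihilators are
combinations of the `f` annihilators. At each site at most three localized states meet, with
directions at `120°` to each other, so that the three symmetric products of different directions are
linearly independent. Therefore the interactions vanish exactly if `f_{R↑} f_{R'↓} - f_{R↓} f_{R'↑}`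
annihilates the state for all overlapping `R`, `R'`, including `R = R'` (`isUnfrustrated_iff`).

*Cluster states.* A flat-band state without doubly occupied labels is determined by its amplitudes
for `f` electrons alone (`eq_zero_of_amp_eq_zero`). These are symmetric under the exchange of the
spins on overlapping labels, so they depend only on the set `A` of occupied labels and on the number
of down spins in each cluster of `A` (`amp_eq_of_downs_eq`). The cluster state has exactly one
prescribed value of these numbers (`hasDowns_clusterState`). Commuting the lowering operators of
clusters with the annihilators shows that it is itself unfrustrated (`IsGroundOn.spinLower`).
-/

/-! ### Fermionic operators on Fock space -/

namespace FlatBand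

open scoped InnerProductSpace

section Fock

variable {M : Type*} [Fintype M]

theorem jwSign_mul_self (x : M) (S : Finset M) : jwSign x S * jwSign x S = 1 := by
  rw [jwSign, ← mul_pow]; norm_num

theorem jwSign_ne_zero (x : M) (S : Finset M) : jwSign x S ≠ 0 :=
  fun h => by simpa [h] using jwSign_mul_self x S

theorem conj_jwSign (x : M) (S : Finset M) : (starRingEnd ℂ) (jwSign x S) = jwSign x S := by
  simp [jwSign]

open Classical in
theorem jwSign_insert_self (x : M) (S : Finset M) : jwSign x (insert x S) = jwSign x S := by
  simp [jwSign, Finset.filter_insert]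

open Classical in
theorem jwSign_erase_self (x : M) (S : Finset M) : jwSign x (S.erase x) = jwSign x S := by
  rw [← jwSign_insert_self x (S.erase x)]
  by_cases h : x ∈ S
  · rw [Finset.insert_erase h]
  · rw [Finset.erase_eq_of_notMem h, jwSign_insert_self]

open Classical in
theorem jwSign_insert {x y : M} {S : Finset M} (hx : x ∉ S) :
    jwSign y (insert x S) =
      (if Fintype.equivFin M x < Fintype.equivFin M y then -1 else 1) * jwSign y S := by
  unfold jwSign
  rw [Finset.filter_insert]
  split_ifs with h
  · rw [Finset.card_insert_of_notMem (by simp [hx]), pow_succ]; ring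
  · simp

open Classical in
theorem jwSign_mul_insert_comm {x y : M} {S : Finset M} (hxy : x ≠ y) (hx : x ∉ S) (hy : y ∉ S) :
    jwSign x S * jwSign y (insert x S) = -(jwSign y S * jwSign x (insert y S)) := by
  rw [jwSign_insert hx, jwSign_insert hy]
  have : Fintype.equivFin M x ≠ Fintype.equivFin M y := fun h => hxy (Equiv.injective _ h)
  rcases lt_or_gt_of_ne this with h | h
  · rw [if_pos h, if_neg h.le.not_gt]; ring
  · rw [if_neg h.le.not_gt, if_pos h]; ring

open Classical in
theorem ann_apply (x : M) (ψ : Fock M) (S : Finset M) :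
    ann x ψ S = if x ∈ S then 0 else jwSign x S * ψ (insert x S) := rfl

open Classical in
theorem dag_ann_apply (x : M) (ψ : Fock M) (S : Finset M) :
    dag (ann x) ψ S = if x ∈ S then jwSign x S * ψ (S.erase x) else 0 := by
  let T : Op M :=
    { toFun := fun ψ => WithLp.toLp 2
        (fun S => if x ∈ S then jwSign x S * ψ (S.erase x) else 0)
      map_add' := fun ψ χ => by ext S; by_cases h : x ∈ S <;> simp [h, mul_add]
      map_smul' := fun a ψ => by ext S; by_cases h : x ∈ S <;> simp [h, mul_left_comm] }
  have hT : T = dag (ann x) := by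
    unfold dag
    rw [LinearMap.eq_adjoint_iff]
    intro ψ χ
    simp only [PiLp.inner_apply, RCLike.inner_apply]
    rw [← Finset.sum_filter_add_sum_filter_not Finset.univ (fun S : Finset M => x ∈ S),
      ← Finset.sum_filter_add_sum_filter_not (s := Finset.univ) (p := fun S : Finset M => x ∈ S)
        (f := fun S => ann x χ S * _)]
    have h1 : ∑ S with ¬ x ∈ S, χ S * (starRingEnd ℂ) (T ψ S) = 0 :=
      Finset.sum_eq_zero fun S hS => by
        have : x ∉ S := by simpa using hS
        simp [T, this]
    have h2 : ∑ S with x ∈ S, ann x χ S * (starRingEnd ℂ) (ψ S) = 0 :=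
      Finset.sum_eq_zero fun S hS => by
        have : x ∈ S := by simpa using hS
        simp [ann_apply, this]
    rw [h1, h2, add_zero, zero_add]
    refine Finset.sum_nbij' (fun S => S.erase x) (fun S => insert x S) ?_ ?_ ?_ ?_ ?_
    · intro S _; simp
    · intro S _; simp
    · intro S hS; exact Finset.insert_erase (by simpa using hS)
    · intro S hS; exact Finset.erase_insert (by simpa using hS)
    · intro S hS
      have : x ∈ S := by simpa using hS
      simp [T, ann_apply, this, jwSign_erase_self, conj_jwSign, Finset.insert_erase]
      ring
  rw [← hT]
  rfl

theorem ann_mul_ann (x y : M) : ann x * ann y = -(ann y * ann x) := by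
  classical
  ext ψ S
  simp only [Module.End.mul_apply, LinearMap.neg_apply, PiLp.neg_apply, ann_apply,
    Finset.mem_insert]
  by_cases hxy : x = y
  · subst hxy; simp
  · by_cases hx : x ∈ S <;> by_cases hy : y ∈ S <;> simp [hx, hy, hxy, Ne.symm hxy]
    rw [← mul_assoc, jwSign_mul_insert_comm hxy hx hy, Finset.insert_comm]
    ring

open Classical in
/-- The canonical anticommutation relation between annihilators and creators. -/
theorem ann_mul_dag_ann (x y : M) :
    ann x * dag (ann y) = (if x = y then 1 else 0) - dag (ann y) * ann x := by
  ext ψ S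
  by_cases hxy : x = y
  · subst hxy
    simp only [Module.End.mul_apply, LinearMap.sub_apply, PiLp.sub_apply, ann_apply,
      dag_ann_apply, if_true, Module.End.one_apply]
    by_cases hx : x ∈ S
    · simp [hx, jwSign_erase_self, ← mul_assoc, jwSign_mul_self, Finset.insert_erase]
    · simp [hx, jwSign_insert_self, ← mul_assoc, jwSign_mul_self]
  · simp only [Module.End.mul_apply, LinearMap.sub_apply, PiLp.sub_apply, ann_apply,
      dag_ann_apply, if_neg hxy, LinearMap.zero_apply, PiLp.zero_apply]
    by_cases hx : x ∈ S <;> by_cases hy : y ∈ S <;> simp [hx, hy, hxy, Ne.symm hxy]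
    obtain ⟨S, hyS, rfl⟩ : ∃ S', y ∉ S' ∧ insert y S' = S :=
      ⟨S.erase y, by simp, Finset.insert_erase hy⟩
    have hxS : x ∉ S := fun h => hx (Finset.mem_insert_of_mem h)
    have e1 : (insert x (insert y S)).erase y = insert x S := by
      rw [Finset.insert_comm, Finset.erase_insert]
      simp [hyS, Ne.symm hxy]
    rw [e1, Finset.erase_insert hyS, Finset.insert_comm, jwSign_insert_self, jwSign_insert_self]
    have := jwSign_mul_insert_comm hxy hxS hyS
    linear_combination ψ (insert x S) * (jwSign x S * jwSign x (insert y S) * this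
      - jwSign y (insert x S) * jwSign x (insert y S) * jwSign_mul_self x S
      - jwSign y S * jwSign x S * jwSign_mul_self x (insert y S))

theorem dag_sub (S T : Op M) : dag (S - T) = dag S - dag T := map_sub LinearMap.adjoint S T

theorem dag_sum {ι : Type*} (s : Finset ι) (T : ι → Op M) :
    dag (∑ i ∈ s, T i) = ∑ i ∈ s, dag (T i) := map_sum LinearMap.adjoint T s

theorem dag_mul (S T : Op M) : dag (S * T) = dag T * dag S := LinearMap.adjoint_comp S T

theorem dag_dag (T : Op M) : dag (dag T) = T := LinearMap.adjoint_adjoint T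

theorem dag_ofReal_smul (a : ℝ) (T : Op M) : dag ((a : ℂ) • T) = (a : ℂ) • dag T := by
  rw [dag, map_smulₛₗ, Complex.conj_ofReal, dag]

theorem inner_dag_mul_self (T : Op M) (ψ : Fock M) :
    ⟪ψ, (dag T * T) ψ⟫_ℂ = ((‖T ψ‖ ^ 2 : ℝ) : ℂ) := by
  rw [Module.End.mul_apply, dag, LinearMap.adjoint_inner_right, inner_self_eq_norm_sq_to_K]
  simp

theorem dag_ann_apply_empty (x : M) (ψ : Fock M) : dag (ann x) ψ ∅ = 0 := by
  classical
  simp [dag_ann_apply]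

theorem ann_vacuum (x : M) : ann x (vacuum : Fock M) = 0 := by
  classical
  ext S
  simp [ann_apply, vacuum]

theorem vacuum_apply_empty : (vacuum : Fock M) ∅ = 1 := by
  simp [vacuum]

theorem vacuum_mem_sector : (vacuum : Fock M) ∈ sector (M := M) 0 := by
  intro S hS
  have : S ≠ ∅ := by rintro rfl; simp at hS
  simp [vacuum, this]

theorem ann_mem_sector (x : M) {n : ℕ} {ψ : Fock M} (h : ψ ∈ sector (M := M) (n + 1)) :
    ann x ψ ∈ sector (M := M) n := by
  classical
  intro S hS
  rw [ann_apply]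
  split_ifs with hx
  · rfl
  · rw [h _ (by rw [Finset.card_insert_of_notMem hx]; omega), mul_zero]

theorem ann_mem_sector_zero (x : M) {ψ : Fock M} (h : ψ ∈ sector (M := M) 0) : ann x ψ = 0 := by
  classical
  ext S
  rw [ann_apply]
  split_ifs with hx
  · rfl
  · rw [h _ (by rw [Finset.card_insert_of_notMem hx]; omega), mul_zero]; rfl

theorem dag_ann_mem_sector (x : M) {n : ℕ} {ψ : Fock M} (h : ψ ∈ sector (M := M) n) :
    dag (ann x) ψ ∈ sector (M := M) (n + 1) := by
  classical
  intro S hS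
  rw [dag_ann_apply]
  split_ifs with hx
  · rw [h _ ?_, mul_zero]
    intro h'
    rw [Finset.card_erase_of_mem hx] at h'
    have := Finset.card_pos.mpr ⟨x, hx⟩
    omega
  · rfl

open Classical in
theorem dag_ann_mul_ann_apply (x : M) (ψ : Fock M) (S : Finset M) :
    (dag (ann x) * ann x) ψ S = if x ∈ S then ψ S else 0 := by
  rw [Module.End.mul_apply, dag_ann_apply]
  by_cases hx : x ∈ S
  · simp [hx, ann_apply, jwSign_erase_self, ← mul_assoc, jwSign_mul_self, Finset.insert_erase]
  · simp [hx]

theorem sum_number_apply {n : ℕ} {ψ : Fock M} (h : ψ ∈ sector (M := M) n) :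
    (∑ x : M, dag (ann x) * ann x) ψ = (n : ℂ) • ψ := by
  classical
  ext S
  rw [LinearMap.sum_apply, WithLp.ofLp_sum, Finset.sum_apply]
  simp only [dag_ann_mul_ann_apply, Finset.sum_ite_mem, Finset.univ_inter, Finset.sum_const,
    nsmul_eq_mul, PiLp.smul_apply, smul_eq_mul]
  by_cases hS : S.card = n
  · rw [hS]
  · rw [h S hS]; simp

/-- A space of states that is stable under all annihilators is trivial as soon as its elements have
no vacuum component: the amplitude of `ψ` at `S` is, up to sign, the vacuum amplitude of the state
in which the modes in `S` have been annihilated. -/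
theorem eq_zero_of_ann_stable (V : Submodule ℂ (Fock M)) (hV : ∀ x, ∀ ψ ∈ V, ann x ψ ∈ V)
    (h0 : ∀ ψ ∈ V, ψ ∅ = 0) : ∀ ψ ∈ V, ψ = 0 := by
  classical
  have key : ∀ S : Finset M, ∀ ψ ∈ V, ψ S = 0 := by
    intro S
    induction S using Finset.induction_on with
    | empty => exact h0
    | insert x S hx ih =>
      intro ψ hψ
      have := ih _ (hV x ψ hψ)
      rw [ann_apply, if_neg hx] at this
      exact (mul_eq_zero.mp this).resolve_left (jwSign_ne_zero x S)
  intro ψ hψ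
  ext S
  exact key S ψ hψ

end Fock

end FlatBand

/-! ### One-body operators -/

namespace FlatBand

section OneBody

variable {O : Type*} [Fintype O]

/-- The annihilation operator `∑ₒ g(o) c_σ(o)` of spin `σ` attached to a real one-particle
functional `g`. -/
noncomputable def annOf (σ : Fin 2) (g : O → ℝ) : Op (O × Fin 2) := ∑ o, (g o : ℂ) • ann (o, σ)

theorem annOf_single [DecidableEq O] (σ : Fin 2) (o : O) :
    annOf σ (fun o' => if o' = o then 1 else 0) = ann (o, σ) := by
  rw [annOf, Finset.sum_eq_single o]
  · simp
  · intro b _ hb; simp [hb]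
  · simp

theorem annOf_zero (σ : Fin 2) : annOf σ (0 : O → ℝ) = 0 := by
  simp [annOf]

theorem annOf_smul (σ : Fin 2) (a : ℝ) (g : O → ℝ) : annOf σ (a • g) = (a : ℂ) • annOf σ g := by
  simp [annOf, Finset.smul_sum, mul_smul]

theorem annOf_sub (σ : Fin 2) (g h : O → ℝ) : annOf σ (g - h) = annOf σ g - annOf σ h := by
  simp [annOf, sub_smul, Finset.sum_sub_distrib]

theorem annOf_sum {ι : Type*} (σ : Fin 2) (s : Finset ι) (g : ι → O → ℝ) :
    annOf σ (∑ i ∈ s, g i) = ∑ i ∈ s, annOf σ (g i) := by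
  simp only [annOf, Finset.sum_apply, Complex.ofReal_sum, Finset.sum_smul]
  exact Finset.sum_comm

theorem annOf_mul_ann (σ : Fin 2) (g : O → ℝ) (x : O × Fin 2) :
    annOf σ g * ann x = -(ann x * annOf σ g) := by
  simp only [annOf, Finset.sum_mul, Finset.mul_sum, smul_mul_assoc, mul_smul_comm,
    ← Finset.sum_neg_distrib, ann_mul_ann _ x, smul_neg]

/-- Second quantization of a real one-particle matrix `A`: the operator
`∑ A(o, o') c†_σ(o) c_σ(o')`, summed over both orbitals and the spin. -/
noncomputable def secondQuant : Matrix O O ℝ →+ Op (O × Fin 2) where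
  toFun A := ∑ σ : Fin 2, ∑ o, ∑ o', (A o o' : ℂ) • (dag (ann (o, σ)) * ann (o', σ))
  map_zero' := by simp
  map_add' A B := by simp [add_smul, Finset.sum_add_distrib]

theorem secondQuant_apply (A : Matrix O O ℝ) :
    secondQuant A = ∑ σ : Fin 2, ∑ o, ∑ o', (A o o' : ℂ) • (dag (ann (o, σ)) * ann (o', σ)) :=
  rfl

theorem secondQuant_smul (a : ℝ) (A : Matrix O O ℝ) :
    secondQuant (a • A) = (a : ℂ) • secondQuant A := by
  simp [secondQuant_apply, Finset.smul_sum, mul_smul]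

theorem sum_dag_annOf_mul_annOf (g h : O → ℝ) :
    ∑ σ, dag (annOf σ g) * annOf σ h = secondQuant (Matrix.vecMulVec g h) := by
  rw [secondQuant_apply]
  refine Finset.sum_congr rfl fun σ _ => ?_
  simp only [annOf, dag_sum, dag_ofReal_smul, Finset.sum_mul, Finset.mul_sum, smul_mul_assoc,
    mul_smul_comm, Matrix.vecMulVec_apply, Complex.ofReal_mul, mul_smul, Finset.smul_sum]
  rw [Finset.sum_comm]
  exact Finset.sum_congr rfl fun o _ => Finset.sum_congr rfl fun o' _ => smul_comm _ _ _

open Matrix in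
theorem vecMulVec_quadratic (g h x : O → ℝ) :
    x ⬝ᵥ (vecMulVec g h).mulVec x = (g ⬝ᵥ x) * (h ⬝ᵥ x) := by
  rw [vecMulVec_mulVec, dotProduct_smul, dotProduct_comm x g]
  simp

/-- A symmetric real matrix is determined by its quadratic form. -/
theorem eq_of_quadratic_form_eq {A B : Matrix O O ℝ} (hA : A.IsSymm) (hB : B.IsSymm)
    (h : ∀ x : O → ℝ, x ⬝ᵥ A.mulVec x = x ⬝ᵥ B.mulVec x) : A = B := by
  classical
  have key : ∀ x y : O → ℝ, x ⬝ᵥ A.mulVec y = x ⬝ᵥ B.mulVec y := by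
    intro x y
    have hs : ∀ C : Matrix O O ℝ, C.IsSymm → y ⬝ᵥ C.mulVec x = x ⬝ᵥ C.mulVec y := by
      intro C hC
      rw [dotProduct_comm, ← Matrix.vecMul_transpose, hC.eq, Matrix.dotProduct_mulVec]
    have := h (x + y)
    simp only [Matrix.mulVec_add, dotProduct_add, add_dotProduct, h x, h y, hs A hA,
      hs B hB] at this
    linarith
  ext i j
  simpa [Matrix.mulVec_single_one, single_dotProduct] using
    key (Pi.single i 1) (Pi.single j 1)

end OneBody

end FlatBand

/-! ### Geometry of the two-layer lattice -/

namespace FlatBand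

section PlaneLattice

theorem colour_mk (m n : ℤ) : colour (m, n) = (m : ZMod 3) - (n : ZMod 3) := by
  simp [colour]

theorem uPerp_eq : uPerp = ![![0, 1], ![-(√3 / 2), 1 / 2], ![-(√3 / 2), -(1 / 2)], ![0, -1],
    ![√3 / 2, -(1 / 2)], ![√3 / 2, 1 / 2]] := by
  have e2 : (2 : ℝ) * (Real.pi / 3) = Real.pi - Real.pi / 3 := by ring
  have e3 : (3 : ℝ) * (Real.pi / 3) = Real.pi := by ring
  have e4 : (4 : ℝ) * (Real.pi / 3) = Real.pi / 3 + Real.pi := by ring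
  have e5 : (5 : ℝ) * (Real.pi / 3) = -(Real.pi / 3) + 2 * Real.pi := by ring
  ext i d
  fin_cases i <;> fin_cases d <;>
    simp [uPerp, e2, e3, e4, e5, Real.sin_pi_sub, Real.cos_pi_sub, Real.sin_add_pi,
      Real.cos_add_pi, Real.sin_add_two_pi, Real.cos_add_two_pi]

theorem uPerp_one_ne_zero (i : Fin 6) : uPerp i 1 ≠ 0 := by
  rw [uPerp_eq]
  fin_cases i <;> simp

/-- Two different corners of a plaquette on the same sublattice differ by a nearest-neighbour vector
of the lattice of plaquettes. -/
theorem exists_wVec_eq_uVec_sub {i j : Fin 6} (hij : i ≠ j)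
    (hc : colour (uVec i) = colour (uVec j)) : ∃ k, wVec k = uVec i - uVec j := by
  have hc' : (i : ℕ) % 2 = (j : ℕ) % 2 := by
    revert hc
    fin_cases i <;> fin_cases j <;> simp only [uVec] <;> decide
  clear hc
  revert i j
  decide

/-- Of the three vectors `uᵢ^⊥` with `i` of a given parity, the direction orthogonal to the third
detects the other two. -/
theorem exists_detecting_direction {i j : Fin 6} (hij : i ≠ j)
    (hc : colour (uVec i) = colour (uVec j)) :
    ∃ e : Fin 2 → ℝ, e ⬝ᵥ uPerp i ≠ 0 ∧ e ⬝ᵥ uPerp j ≠ 0 ∧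
      ∀ k, colour (uVec k) = colour (uVec i) → k ≠ i → k ≠ j → e ⬝ᵥ uPerp k = 0 := by
  have par : ∀ a b : Fin 6, colour (uVec a) = colour (uVec b) → (a : ℕ) % 2 = (b : ℕ) % 2 := by
    intro a b h
    revert h
    fin_cases a <;> fin_cases b <;> simp only [uVec] <;> decide
  have hp := par i j hc
  -- Modulo `6`, the third index of the same parity is `2 i - j`.
  refine ⟨![uPerp (2 * i - j) 1, -uPerp (2 * i - j) 0], ?_, ?_, ?_⟩
  · rw [uPerp_eq]
    clear hc
    revert hij hp
    fin_cases i <;> fin_cases j <;> simp [dotProduct, Fin.sum_univ_two] <;>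
      norm_num [Fin.sub_def] <;> nlinarith [Real.sqrt_pos.mpr (show (0 : ℝ) < 3 by norm_num)]
  · rw [uPerp_eq]
    clear hc
    revert hij hp
    fin_cases i <;> fin_cases j <;> simp [dotProduct, Fin.sum_univ_two] <;>
      norm_num [Fin.sub_def] <;> nlinarith [Real.sqrt_pos.mpr (show (0 : ℝ) < 3 by norm_num)]
  · intro k hk hki hkj
    have hk' := par k i hk
    have : k = 2 * i - j := by
      clear hk hc
      revert i j k
      decide
    subst this
    simp [dotProduct, Fin.sum_univ_two]
    ring

theorem sum_vHat_dotProduct_sq (a : Fin 2 → ℝ) :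
    ∑ k, (vHat k ⬝ᵥ a) ^ 2 = 3 / 2 * (a ⬝ᵥ a) := by
  have h3 : √3 ^ 2 = 3 := Real.sq_sqrt (by norm_num)
  simp [Fin.sum_univ_three, vHat, dotProduct, Fin.sum_univ_two]
  linear_combination (1 / 2 * a 1 ^ 2) * h3

/-- The Gram matrix of the plaquette functions `∑ᵢ (-1)^i uᵢ^⊥ δ_{R + uᵢ}` is `6` on the diagonal
and `-1` between neighbouring plaquettes. -/
theorem sum_sum_uPerp_mul {f : ℤ × ℤ → ℝ} (hf : ∀ z, colour z ≠ 0 → f z = 0) :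
    ∑ i : Fin 6, ∑ j : Fin 6, (-1) ^ (i : ℕ) * ((-1) ^ (j : ℕ) * f (uVec i - uVec j)) *
      (uPerp i ⬝ᵥ uPerp j) = 6 * f 0 - ∑ i, f (wVec i) := by
  have hz : ∀ m n : ℤ, (m : ZMod 3) - (n : ZMod 3) ≠ 0 → f (m, n) = 0 := fun m n h =>
    hf _ (by rwa [colour_mk])
  have a0 := hz 1 0 (by decide)
  have a1 := hz 0 1 (by decide)
  have a2 := hz (-1) 1 (by decide)
  have a3 := hz (-1) 0 (by decide)
  have a4 := hz 0 (-1) (by decide)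
  have a5 := hz 1 (-1) (by decide)
  have b0 := hz 2 0 (by decide)
  have b1 := hz 0 2 (by decide)
  have b2 := hz (-2) 2 (by decide)
  have b3 := hz (-2) 0 (by decide)
  have b4 := hz 0 (-2) (by decide)
  have b5 := hz 2 (-2) (by decide)
  rw [uPerp_eq]
  simp only [Fin.sum_univ_six, dotProduct, Fin.sum_univ_two, uVec, wVec]
  simp [a0, a1, a2, a3, a4, a5, b0, b1, b2, b3, b4, b5]
  ring_nf
  simp
  ring

/-- The plaquette functions are annihilated by the bonding combination of each honeycomb bond. -/
theorem vHat_dotProduct_plaquette {f : ℤ × ℤ → ℝ} (hf : ∀ z, colour z ≠ 2 → f z = 0) (k : Fin 3) :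
    vHat k ⬝ᵥ (∑ i : Fin 6, ((-1) ^ (i : ℕ) * f (-uVec i)) • uPerp i) +
      vHat k ⬝ᵥ (∑ i : Fin 6, ((-1) ^ (i : ℕ) * f (vVec k - uVec i)) • uPerp i) = 0 := by
  have hz : ∀ m n : ℤ, (m : ZMod 3) - (n : ZMod 3) ≠ 2 → f (m, n) = 0 := fun m n h =>
    hf _ (by rwa [colour_mk])
  have a0 := hz 1 0 (by decide)
  have a1 := hz (-1) 1 (by decide)
  have a2 := hz 0 (-1) (by decide)
  have b1 := hz 1 1 (by decide)
  have b2 := hz 2 (-1) (by decide)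
  have b3 := hz 1 (-2) (by decide)
  have b4 := hz (-1) 2 (by decide)
  have b5 := hz (-2) 1 (by decide)
  have b6 := hz (-1) (-1) (by decide)
  rw [uPerp_eq]
  fin_cases k <;>
  simp [Fin.sum_univ_six, dotProduct, Fin.sum_univ_two, uVec, vVec, vHat, a0, a1, a2, b1, b2, b3,
    b4, b5, b6] <;>
  ring_nf

theorem sum_sub_right {G : Type*} [AddCommGroup G] {s t : Finset G} {a : G} {f : G → ℝ}
    (hst : ∀ R ∈ s, R + a ∈ t) (hf : ∀ R, R ∉ s → f R = 0) :
    ∑ r ∈ t, f (r - a) = ∑ R ∈ s, f R := by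
  classical
  rw [← Finset.sum_subset (s₁ := s.image (· + a)) (f := fun r => f (r - a))]
  · rw [Finset.sum_image (fun _ _ _ _ h => add_right_cancel h)]
    simp
  · intro r hr
    obtain ⟨R, hR, rfl⟩ := Finset.mem_image.mp hr
    exact hst R hR
  · intro r _ hr
    refine hf _ fun h => hr (Finset.mem_image.mpr ⟨_, h, by simp⟩)

end PlaneLattice
end FlatBand

/-! ### The one-particle quadratic form -/

namespace FlatBand

namespace TwoLayer

variable (L : TwoLayer)

theorem siteColour_coe (z : ℤ × ℤ) : L.siteColour (z : L.Site) = colour z := rfl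

theorem siteColour_of_mem_Λf {R : L.Site} (h : R ∈ L.Λf) : L.siteColour R = 0 := by
  induction R using QuotientAddGroup.induction_on with
  | H z => exact L.colour_f z h

theorem siteColour_of_mem_Λp {r : L.Site} (h : r ∈ L.Λp) : L.siteColour r ≠ 0 := by
  induction r using QuotientAddGroup.induction_on with
  | H z => exact L.colour_p z h

theorem siteColour_vVec (k : Fin 3) : L.siteColour (vVec k : L.Site) = 1 := by
  rw [siteColour_coe]
  fin_cases k <;> simp only [vVec] <;> decide

open Classical in
/-- The sites of sublattice `A` that belong to a bond, with direction `vVec k` for some `k`, at least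
one of whose ends lies in `Λ_p`. -/
noncomputable def bondSites : Finset L.Site :=
  L.ΛpA ∪ (Finset.univ : Finset (Fin 3)).biUnion
    fun k => (L.Λp.filter fun r => L.siteColour r = 2).image (· - (vVec k : L.Site))

theorem siteColour_of_mem_bondSites {r : L.Site} (h : r ∈ L.bondSites) : L.siteColour r = 1 := by
  classical
  rw [bondSites, Finset.mem_union, Finset.mem_biUnion] at h
  rcases h with h | ⟨k, -, h⟩
  · exact (Finset.mem_filter.mp h).2
  · obtain ⟨r', hr', rfl⟩ := Finset.mem_image.mp h
    rw [map_sub, (Finset.mem_filter.mp hr').2, siteColour_vVec]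
    decide

/-- The sum over all honeycomb bonds of the squared (anti)bonding amplitude of a `p`-orbital
wavefunction. It is complete in the sense that the two amplitudes of a bond contribute a multiple
of the identity, because `∑ₖ vₖ vₖᵀ = 3/2`. -/
theorem sum_bond_sq {Y : L.Site → Fin 2 → ℝ} (hY : ∀ r, r ∉ L.Λp → Y r = 0) {s : ℝ}
    (hs : s ^ 2 = 1) :
    ∑ r ∈ L.bondSites, ∑ k, (vHat k ⬝ᵥ Y r + s * (vHat k ⬝ᵥ Y (r + (vVec k : L.Site)))) ^ 2 =
      3 / 2 * ∑ r ∈ L.Λp, Y r ⬝ᵥ Y r +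
        2 * s * ∑ r ∈ L.ΛpA, ∑ k,
          (vHat k ⬝ᵥ Y r) * (vHat k ⬝ᵥ Y (r + (vVec k : L.Site))) := by
  classical
  have hsub : L.ΛpA ⊆ L.bondSites := Finset.subset_union_left
  have hnot : ∀ r ∈ L.bondSites, r ∉ L.ΛpA → Y r = 0 := by
    intro r hr hrA
    refine hY r fun h => hrA ?_
    exact Finset.mem_filter.mpr ⟨h, L.siteColour_of_mem_bondSites hr⟩
  have h1 : ∑ r ∈ L.bondSites, ∑ k, (vHat k ⬝ᵥ Y r) ^ 2 =
      3 / 2 * ∑ r ∈ L.ΛpA, Y r ⬝ᵥ Y r := by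
    rw [Finset.mul_sum, ← Finset.sum_subset hsub]
    · exact Finset.sum_congr rfl fun r _ => sum_vHat_dotProduct_sq _
    · intro r hr hrA
      simp [hnot r hr hrA]
  have h2 : ∑ r ∈ L.bondSites, ∑ k, (vHat k ⬝ᵥ Y r) * (vHat k ⬝ᵥ Y (r + (vVec k : L.Site))) =
      ∑ r ∈ L.ΛpA, ∑ k, (vHat k ⬝ᵥ Y r) * (vHat k ⬝ᵥ Y (r + (vVec k : L.Site))) := by
    rw [← Finset.sum_subset hsub]
    intro r hr hrA
    simp [hnot r hr hrA]
  have h3 : ∑ r ∈ L.bondSites, ∑ k, (vHat k ⬝ᵥ Y (r + (vVec k : L.Site))) ^ 2 =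
      3 / 2 * ∑ r ∈ L.Λp.filter (fun r => L.siteColour r = 2), Y r ⬝ᵥ Y r := by
    rw [Finset.sum_comm, Finset.mul_sum]
    simp_rw [← sum_vHat_dotProduct_sq]
    rw [Finset.sum_comm (s := L.Λp.filter _)]
    refine Finset.sum_congr rfl fun k _ => ?_
    have := sum_sub_right (s := L.Λp.filter (fun r => L.siteColour r = 2)) (t := L.bondSites)
      (a := -(vVec k : L.Site))
      (f := fun r => if L.siteColour r = 2 then (vHat k ⬝ᵥ Y r) ^ 2 else 0) ?_ ?_
    · rw [Finset.sum_congr rfl (g := fun r => (vHat k ⬝ᵥ Y r) ^ 2)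
        (fun r hr => if_pos (Finset.mem_filter.mp hr).2)] at this
      rw [← this]
      refine Finset.sum_congr rfl fun r hr => ?_
      rw [sub_neg_eq_add, if_pos]
      rw [map_add, siteColour_vVec, L.siteColour_of_mem_bondSites hr]
      decide
    · intro R hR
      rw [bondSites, Finset.mem_union, Finset.mem_biUnion]
      exact Or.inr ⟨k, Finset.mem_univ _, Finset.mem_image.mpr ⟨R, hR, by
        rw [sub_eq_add_neg]⟩⟩
    · intro R hR
      split_ifs with hc
      · rw [hY R fun h => hR (Finset.mem_filter.mpr ⟨h, hc⟩)]
        simp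
      · rfl
  have h4 : ∑ r ∈ L.Λp, Y r ⬝ᵥ Y r = ∑ r ∈ L.ΛpA, Y r ⬝ᵥ Y r +
      ∑ r ∈ L.Λp.filter (fun r => L.siteColour r = 2), Y r ⬝ᵥ Y r := by
    rw [ΛpA, ← Finset.sum_filter_add_sum_filter_not L.Λp (fun r => L.siteColour r = 1)]
    congr 1
    refine Finset.sum_congr (Finset.filter_congr fun r hr => ?_) fun _ _ => rfl
    have := L.siteColour_of_mem_Λp hr
    revert this
    generalize L.siteColour r = c
    revert c
    decide
  have expand : ∀ a b : ℝ, (a + s * b) ^ 2 = a ^ 2 + b ^ 2 + 2 * s * (a * b) := by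
    intro a b
    linear_combination b ^ 2 * hs
  simp_rw [expand, Finset.sum_add_distrib, ← Finset.mul_sum]
  rw [h1, h2, h3, h4]
  ring

/-- The `p`-orbital wavefunction `∑_R F(R) ∑ᵢ (-1)^i uᵢ^⊥ δ_{R + uᵢ}`, a superposition of the
`p` parts of the localized states. -/
noncomputable def plaquetteField (F : L.Site → ℝ) (r : L.Site) : Fin 2 → ℝ :=
  ∑ i : Fin 6, ((-1) ^ (i : ℕ) * F (r - (uVec i : L.Site))) • uPerp i

theorem plaquetteField_eq_zero {F : L.Site → ℝ} (hF : ∀ R, R ∉ L.Λf → F R = 0)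
    {r : L.Site} (hr : r ∉ L.Λp) : L.plaquetteField F r = 0 := by
  refine Finset.sum_eq_zero fun i _ => ?_
  rw [hF _ fun h => hr ?_]
  · simp
  · simpa using L.corner_mem _ h i

theorem vHat_dotProduct_plaquetteField {F : L.Site → ℝ} (hF : ∀ R, R ∉ L.Λf → F R = 0)
    {r : L.Site} (hr : L.siteColour r = 1) (k : Fin 3) :
    vHat k ⬝ᵥ L.plaquetteField F r + vHat k ⬝ᵥ L.plaquetteField F (r + (vVec k : L.Site)) = 0 := by
  have := vHat_dotProduct_plaquette (f := fun z => F (r + (z : L.Site))) ?_ k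
  · rw [← this]
    simp [plaquetteField, sub_eq_add_neg, add_assoc]
  · intro z hz
    refine hF _ fun h => hz ?_
    have := L.siteColour_of_mem_Λf h
    rw [map_add, hr, siteColour_coe] at this
    rw [eq_neg_of_add_eq_zero_right this]
    decide

theorem sum_dotProduct_plaquetteField {F : L.Site → ℝ} (hF : ∀ R, R ∉ L.Λf → F R = 0)
    (Y : L.Site → Fin 2 → ℝ) :
    ∑ r ∈ L.Λp, Y r ⬝ᵥ L.plaquetteField F r =
      ∑ R ∈ L.Λf, ∑ i : Fin 6, (-1) ^ (i : ℕ) * (F R * (uPerp i ⬝ᵥ Y (R + (uVec i : L.Site)))) := by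
  simp only [plaquetteField, dotProduct_sum, dotProduct_smul, smul_eq_mul]
  rw [Finset.sum_comm, Finset.sum_comm (s := L.Λf)]
  refine Finset.sum_congr rfl fun i _ => ?_
  rw [← sum_sub_right (a := (uVec i : L.Site)) (fun R hR => L.corner_mem R hR i)]
  · refine Finset.sum_congr rfl fun r _ => ?_
    rw [sub_add_cancel, dotProduct_comm (Y r)]
    ring
  · intro R hR
    simp [hF R hR]

theorem sum_plaquetteField_sq {F : L.Site → ℝ} (hF : ∀ R, R ∉ L.Λf → F R = 0) :
    ∑ r ∈ L.Λp, L.plaquetteField F r ⬝ᵥ L.plaquetteField F r =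
      6 * ∑ R ∈ L.Λf, F R ^ 2 - ∑ R ∈ L.Λf, ∑ i, F (R + (wVec i : L.Site)) * F R := by
  rw [L.sum_dotProduct_plaquetteField hF, Finset.mul_sum, ← Finset.sum_sub_distrib]
  refine Finset.sum_congr rfl fun R hR => ?_
  have := sum_sum_uPerp_mul (f := fun z => F (R + (z : L.Site))) ?_
  · have h0 : F (R + ((0 : ℤ × ℤ) : L.Site)) = F R := by
      rw [QuotientAddGroup.mk_zero, add_zero]
    simp only [h0] at this
    rw [← Finset.sum_mul, pow_two, ← mul_assoc, ← sub_mul, ← this]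
    rw [Finset.sum_mul]
    refine Finset.sum_congr rfl fun i _ => ?_
    simp only [plaquetteField, dotProduct_sum, dotProduct_smul, smul_eq_mul, Finset.mul_sum,
      Finset.sum_mul]
    refine Finset.sum_congr rfl fun j _ => ?_
    rw [QuotientAddGroup.mk_sub, add_sub_assoc]
    ring
  · intro z hz
    refine hF _ fun h => hz ?_
    have := L.siteColour_of_mem_Λf h
    rwa [map_add, L.siteColour_of_mem_Λf hR, zero_add, siteColour_coe] at this

/-- The one-particle energy of the flat band, measured without the interaction shifts. -/
noncomputable def _root_.FlatBand.Couplings.flatEnergy (K : Couplings) : ℝ :=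
  K.μp + 3 / 2 * K.tp - K.tfp ^ 2 / K.tf

/-- The one-particle quadratic form is the flat-band energy plus squares, whose coefficients are
positive if `t_fp² > 3 t_p t_f`. The squares involve only the `p`-orbital wavefunction
`Y - (t_f / t_fp) plaquetteField F`, which measures the deviation from the flat band. -/
theorem one_particle_identity (K : Couplings) (htf : K.tf ≠ 0) (htfp : K.tfp ≠ 0)
    {F : L.Site → ℝ} (hF : ∀ R, R ∉ L.Λf → F R = 0)
    {Y Z : L.Site → Fin 2 → ℝ} (hY : ∀ r, r ∉ L.Λp → Y r = 0)
    (hZ : ∀ r, Z r = Y r - (K.tf / K.tfp) • L.plaquetteField F r) :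
    -(K.tp * (2 * ∑ r ∈ L.ΛpA, ∑ k,
          (vHat k ⬝ᵥ Y r) * (vHat k ⬝ᵥ Y (r + (vVec k : L.Site)))))
      - K.tf * ∑ R ∈ L.Λf, ∑ i, F (R + (wVec i : L.Site)) * F R
      - K.tfp * (2 * ∑ R ∈ L.Λf, ∑ i : Fin 6,
          (-1) ^ (i : ℕ) * (F R * (uPerp i ⬝ᵥ Y (R + (uVec i : L.Site)))))
      + K.μp * ∑ r ∈ L.Λp, Y r ⬝ᵥ Y r + K.μfc * ∑ R ∈ L.Λf, F R ^ 2 =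
    K.flatEnergy * (∑ r ∈ L.Λp, Y r ⬝ᵥ Y r + ∑ R ∈ L.Λf, F R ^ 2)
      + (K.tfp ^ 2 / K.tf - 3 * K.tp) * ∑ r ∈ L.Λp, Z r ⬝ᵥ Z r
      + K.tp * ∑ r ∈ L.bondSites, ∑ k,
          (vHat k ⬝ᵥ Z r - vHat k ⬝ᵥ Z (r + (vVec k : L.Site))) ^ 2 := by
  have hZ0 : ∀ r, r ∉ L.Λp → Z r = 0 := by
    intro r hr
    rw [hZ, hY r hr, L.plaquetteField_eq_zero hF hr]
    simp
  have hYp := L.sum_bond_sq hY (s := 1) (by norm_num)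
  have hZp := L.sum_bond_sq hZ0 (s := 1) (by norm_num)
  have hZm := L.sum_bond_sq hZ0 (s := -1) (by norm_num)
  -- The bonding amplitudes do not see the plaquette functions.
  have hYZ : ∑ r ∈ L.bondSites, ∑ k,
        (vHat k ⬝ᵥ Y r + 1 * (vHat k ⬝ᵥ Y (r + (vVec k : L.Site)))) ^ 2 =
      ∑ r ∈ L.bondSites, ∑ k,
        (vHat k ⬝ᵥ Z r + 1 * (vHat k ⬝ᵥ Z (r + (vVec k : L.Site)))) ^ 2 := by
    refine Finset.sum_congr rfl fun r hr => Finset.sum_congr rfl fun k _ => ?_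
    have := L.vHat_dotProduct_plaquetteField hF (L.siteColour_of_mem_bondSites hr) k
    rw [hZ, hZ, dotProduct_sub, dotProduct_sub, dotProduct_smul, dotProduct_smul]
    congr 1
    simp only [smul_eq_mul]
    linear_combination (K.tf / K.tfp) * this
  have hZZ : ∑ r ∈ L.Λp, Z r ⬝ᵥ Z r = ∑ r ∈ L.Λp, Y r ⬝ᵥ Y r
      - 2 * (K.tf / K.tfp) * ∑ r ∈ L.Λp, Y r ⬝ᵥ L.plaquetteField F r
      + (K.tf / K.tfp) ^ 2 * ∑ r ∈ L.Λp, L.plaquetteField F r ⬝ᵥ L.plaquetteField F r := by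
    rw [Finset.mul_sum, Finset.mul_sum, ← Finset.sum_sub_distrib, ← Finset.sum_add_distrib]
    refine Finset.sum_congr rfl fun r _ => ?_
    rw [hZ]
    simp only [dotProduct_sub, sub_dotProduct, dotProduct_smul, smul_dotProduct, smul_eq_mul,
      dotProduct_comm (L.plaquetteField F r) (Y r)]
    ring
  rw [L.sum_dotProduct_plaquetteField hF, L.sum_plaquetteField_sq hF] at hZZ
  simp only [neg_mul, one_mul, ← sub_eq_add_neg] at hZm
  rw [hZm]
  rw [hYZ, hZp] at hYp
  have hcross : ∑ r ∈ L.ΛpA, ∑ k,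
          (vHat k ⬝ᵥ Y r) * (vHat k ⬝ᵥ Y (r + (vVec k : L.Site))) =
      ∑ r ∈ L.ΛpA, ∑ k, (vHat k ⬝ᵥ Z r) * (vHat k ⬝ᵥ Z (r + (vVec k : L.Site)))
        + 3 / 4 * (∑ r ∈ L.Λp, Z r ⬝ᵥ Z r - ∑ r ∈ L.Λp, Y r ⬝ᵥ Y r) := by
    linarith
  rw [hcross, hZZ, Couplings.μfc, Couplings.flatEnergy]
  field_simp
  ring

end TwoLayer
end FlatBand

/-! ### Normal ordering of two-body terms, and one-particle functionals -/

namespace FlatBand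

section TwoBody

variable {M : Type*} [Fintype M]

/-- Normal ordering of a product of two hopping operators on disjoint pairs of modes. -/
theorem hop_mul_hop {a b c d : M} (hbc : b ≠ c) :
    dag (ann a) * ann b * (dag (ann c) * ann d) =
      dag (ann a) * dag (ann c) * (ann d * ann b) := by
  classical
  rw [mul_assoc, ← mul_assoc (ann b), ann_mul_dag_ann, if_neg hbc, zero_sub, neg_mul, mul_assoc,
    ann_mul_ann b d]
  simp [mul_assoc]

theorem number_mul_number {x y : M} (hxy : x ≠ y) :
    dag (ann x) * ann x * (dag (ann y) * ann y) =
      dag (ann y * ann x) * (ann y * ann x) := by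
  rw [hop_mul_hop hxy, dag_mul]

theorem spin_dot_spin (a b : Fin 2 → Fin 2 → Op M) :
    ∑ i : Fin 3, ((1 / 2 : ℂ) • ∑ μ : Fin 2, ∑ ν : Fin 2, TwoLayer.pauli i μ ν • a μ ν) *
        ((1 / 2 : ℂ) • ∑ μ : Fin 2, ∑ ν : Fin 2, TwoLayer.pauli i μ ν • b μ ν)
      - (1 / 4 : ℂ) • ((∑ σ : Fin 2, a σ σ) * ∑ σ : Fin 2, b σ σ) =
    -((1 / 2 : ℂ) • (a 0 0 * b 1 1 + a 1 1 * b 0 0 - a 0 1 * b 1 0 - a 1 0 * b 0 1)) := by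
  simp only [TwoLayer.pauli, Fin.sum_univ_three, Fin.sum_univ_two]
  simp [mul_add, add_mul, smul_smul]
  match_scalars <;> ring_nf <;> simp [Complex.I_sq] <;> norm_num

end TwoBody

namespace TwoLayer

variable (L : TwoLayer)

/-- The one-particle functional `x ↦ x(R)` for the `f` orbital at `R`, zero for a site outside
`Λ_f`. -/
noncomputable def fFun (R : L.Site) : L.Orb → ℝ
  | Sum.inl R' => open Classical in if R'.1 = R then 1 else 0
  | Sum.inr _ => 0

/-- The one-particle functional that takes the component in the direction `e` of the `p` orbitals at
`r`, zero for a site outside `Λ_p`. -/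
noncomputable def pFun (r : L.Site) (e : Fin 2 → ℝ) : L.Orb → ℝ
  | Sum.inl _ => 0
  | Sum.inr (r', d) => open Classical in if r'.1 = r then e d else 0

open Classical in
/-- The component `d` at the site `r` of the `p` part `∑ᵢ (-1)^i uᵢ^⊥ δ_{R + uᵢ}` of the localized
state at `R`. -/
noncomputable def cornerAmp (R r : L.Site) (d : Fin 2) : ℝ :=
  ∑ i : Fin 6, if R + (uVec i : L.Site) = r then (-1) ^ (i : ℕ) * uPerp i d else 0

/-- The one-particle functional that measures the deviation from the flat band: the difference
between the amplitude in the `p` orbital `o` and the amplitude there of the combination of localized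
states with the same `f` part. -/
noncomputable def devFun (K : Couplings) (o : {r : L.Site // r ∈ L.Λp} × Fin 2) : L.Orb → ℝ
  | Sum.inl R => -(K.tf / K.tfp * L.cornerAmp R.1 o.1.1 o.2)
  | Sum.inr o' => open Classical in if o' = o then 1 else 0

/-- The component of `devFun` in the direction `e` at the site `r`, zero for a site outside
`Λ_p`. -/
noncomputable def devDirFun (K : Couplings) (r : L.Site) (e : Fin 2 → ℝ) : L.Orb → ℝ :=
  open Classical in if h : r ∈ L.Λp then ∑ d, e d • L.devFun K (⟨r, h⟩, d) else 0

/-- The `f` part of a one-particle wavefunction. -/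
noncomputable def fPart (x : L.Orb → ℝ) (R : L.Site) : ℝ :=
  open Classical in if h : R ∈ L.Λf then x (Sum.inl ⟨R, h⟩) else 0

/-- The `p` part of a one-particle wavefunction. -/
noncomputable def pPart (x : L.Orb → ℝ) (r : L.Site) (d : Fin 2) : ℝ :=
  open Classical in if h : r ∈ L.Λp then x (Sum.inr (⟨r, h⟩, d)) else 0

theorem f_eq_annOf (R : L.Site) (σ : Fin 2) : L.f R σ = annOf σ (L.fFun R) := by
  classical
  unfold f
  split_ifs with h
  · rw [c, ← annOf_single]
    congr 1
    ext o
    rcases o with R' | o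
    · simp [fFun, Subtype.ext_iff]
    · simp [fFun]
  · rw [← annOf_zero]
    congr 1
    ext o
    rcases o with R' | o
    · have : R'.1 ≠ R := fun e => h (e ▸ R'.2)
      simp [fFun, this]
    · simp [fFun]

theorem pDir_eq_annOf (r : L.Site) (e : Fin 2 → ℝ) (σ : Fin 2) :
    L.pDir r e σ = annOf σ (L.pFun r e) := by
  classical
  have : L.pFun r e = ∑ d, e d • L.pFun r (Pi.single d 1) := by
    ext o
    rcases o with R' | ⟨r', d⟩
    · simp [pFun]
    · by_cases h : r'.1 = r <;> simp [pFun, h, Pi.single_apply]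
  rw [this, annOf_sum, pDir]
  refine Finset.sum_congr rfl fun d _ => ?_
  rw [annOf_smul]
  congr 1
  unfold p
  split_ifs with h
  · rw [c, ← annOf_single]
    congr 1
    ext o
    rcases o with R' | ⟨r', d'⟩
    · simp [pFun]
    · by_cases h1 : r' = ⟨r, h⟩
      · subst h1
        simp [pFun, Pi.single_apply]
      · have h2 : r'.1 ≠ r := fun e => h1 (Subtype.ext e)
        simp [pFun, h1, h2]
  · rw [← annOf_zero]
    congr 1
    ext o
    rcases o with R' | ⟨r', d'⟩
    · simp [pFun]
    · have : r'.1 ≠ r := fun e => h (e ▸ r'.2)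
      simp [pFun, this]

theorem fFun_dotProduct (R : L.Site) (x : L.Orb → ℝ) : L.fFun R ⬝ᵥ x = L.fPart x R := by
  classical
  simp only [dotProduct, Fintype.sum_sum_type, fFun, fPart, zero_mul, Finset.sum_const_zero,
    add_zero, ite_mul, one_mul]
  split_ifs with h
  · rw [Finset.sum_eq_single (⟨R, h⟩ : L.Label)]
    · simp
    · intro R' _ hR'
      rw [if_neg fun e => hR' (Subtype.ext e)]
    · simp
  · refine Finset.sum_eq_zero fun R' _ => ?_
    rw [if_neg fun e => h (by rw [← e]; exact R'.2)]

theorem pFun_dotProduct (r : L.Site) (e : Fin 2 → ℝ) (x : L.Orb → ℝ) :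
    L.pFun r e ⬝ᵥ x = e ⬝ᵥ L.pPart x r := by
  classical
  simp only [dotProduct, Fintype.sum_sum_type, pFun, pPart, zero_mul, Finset.sum_const_zero,
    zero_add, Fintype.sum_prod_type, ite_mul]
  by_cases h : r ∈ L.Λp
  · rw [Finset.sum_eq_single ⟨r, h⟩]
    · simp [h]
    · intro r' _ hr'
      have : r'.1 ≠ r := fun e => hr' (Subtype.ext e)
      simp [this]
    · simp
  · simp only [dif_neg h, mul_zero, Finset.sum_const_zero]
    refine Finset.sum_eq_zero fun r' _ => Finset.sum_eq_zero fun d _ => ?_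
    rw [if_neg fun e => h (by rw [← e]; exact r'.2)]

theorem sum_cornerAmp_mul (x : L.Orb → ℝ) (r : L.Site) (d : Fin 2) :
    ∑ R : L.Label, L.cornerAmp R.1 r d * x (Sum.inl R) = L.plaquetteField (L.fPart x) r d := by
  classical
  simp only [cornerAmp, plaquetteField, Finset.sum_apply, Finset.sum_mul, Pi.smul_apply,
    smul_eq_mul]
  rw [Finset.sum_comm]
  refine Finset.sum_congr rfl fun i _ => ?_
  rw [← L.fFun_dotProduct, dotProduct, Fintype.sum_sum_type]
  simp only [fFun, zero_mul, Finset.sum_const_zero, add_zero, Finset.mul_sum, Finset.sum_mul]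
  refine Finset.sum_congr rfl fun R _ => ?_
  simp only [← eq_sub_iff_add_eq]
  split_ifs <;> ring

theorem devDirFun_dotProduct (K : Couplings) (r : L.Site) (e : Fin 2 → ℝ) (x : L.Orb → ℝ) :
    L.devDirFun K r e ⬝ᵥ x =
      e ⬝ᵥ (L.pPart x r - (K.tf / K.tfp) • L.plaquetteField (L.fPart x) r) := by
  classical
  have hF : ∀ R, R ∉ L.Λf → L.fPart x R = 0 := fun R hR => dif_neg hR
  unfold devDirFun
  split_ifs with h
  · simp only [sum_dotProduct, smul_dotProduct, smul_eq_mul]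
    rw [dotProduct]
    refine Finset.sum_congr rfl fun d _ => ?_
    congr 1
    simp only [dotProduct, Fintype.sum_sum_type, devFun, Pi.sub_apply, Pi.smul_apply, smul_eq_mul,
      ← L.sum_cornerAmp_mul, Finset.mul_sum]
    simp [pPart, h, mul_assoc]
    ring
  · rw [L.plaquetteField_eq_zero hF h]
    have : L.pPart x r = 0 := funext fun d => dif_neg h
    simp [this]

end TwoLayer
end FlatBand

/-! ### The one-body part of the Hamiltonian -/

namespace FlatBand

namespace TwoLayer

variable (L : TwoLayer)

theorem single_eq_fFun (R : L.Label) (σ : Fin 2) : L.c σ (Sum.inl R) = annOf σ (L.fFun R.1) := by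
  rw [← L.f_eq_annOf, f, dif_pos R.2]

theorem single_eq_pFun (r : {r : L.Site // r ∈ L.Λp}) (d : Fin 2) (σ : Fin 2) :
    L.c σ (Sum.inr (r, d)) = annOf σ (L.pFun r.1 (Pi.single d 1)) := by
  rw [← L.pDir_eq_annOf, pDir, Finset.sum_eq_single d]
  · simp [p, r.2]
  · intro d' _ hd
    simp [hd]
  · simp

open Matrix in
theorem hopP_eq (K : Couplings) : L.hopP K = secondQuant (K.tp • ∑ r ∈ L.ΛpA, ∑ k : Fin 3,
    (vecMulVec (L.pFun (r + (vVec k : L.Site)) (vHat k)) (L.pFun r (vHat k)) +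
      vecMulVec (L.pFun r (vHat k)) (L.pFun (r + (vVec k : L.Site)) (vHat k)))) := by
  rw [hopP, secondQuant_smul, map_sum]
  congr 1
  refine Finset.sum_congr rfl fun r _ => ?_
  rw [Finset.sum_comm, map_sum]
  refine Finset.sum_congr rfl fun k _ => ?_
  simp only [map_add, ← sum_dag_annOf_mul_annOf, dag_mul, dag_dag, pDir_eq_annOf,
    Finset.sum_add_distrib]

open Matrix in
theorem hopF_eq (K : Couplings) : L.hopF K = secondQuant (K.tf • ∑ R ∈ L.Λf, ∑ i : Fin 6,
    vecMulVec (L.fFun (R + (wVec i : L.Site))) (L.fFun R)) := by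
  rw [hopF, secondQuant_smul, map_sum]
  congr 1
  refine Finset.sum_congr rfl fun R _ => ?_
  rw [Finset.sum_comm, map_sum]
  refine Finset.sum_congr rfl fun k _ => ?_
  simp only [← sum_dag_annOf_mul_annOf, f_eq_annOf]

open Matrix in
theorem hopFP_eq (K : Couplings) : L.hopFP K = secondQuant (K.tfp • ∑ R ∈ L.Λf, ∑ i : Fin 6,
    ((-1 : ℝ) ^ (i : ℕ)) • (vecMulVec (L.fFun R) (L.pFun (R + (uVec i : L.Site)) (uPerp i)) +
      vecMulVec (L.pFun (R + (uVec i : L.Site)) (uPerp i)) (L.fFun R))) := by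
  rw [hopFP, secondQuant_smul, map_sum]
  congr 1
  refine Finset.sum_congr rfl fun R _ => ?_
  rw [Finset.sum_comm, map_sum]
  refine Finset.sum_congr rfl fun k _ => ?_
  rw [secondQuant_smul, ← Finset.smul_sum]
  simp only [map_add, ← sum_dag_annOf_mul_annOf, dag_mul, dag_dag, f_eq_annOf, pDir_eq_annOf,
    Finset.sum_add_distrib]
  simp

open Matrix in
theorem Np_eq : L.Np = secondQuant (∑ r : {r : L.Site // r ∈ L.Λp}, ∑ d : Fin 2,
    vecMulVec (L.pFun r.1 (Pi.single d 1)) (L.pFun r.1 (Pi.single d 1))) := by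
  simp only [Np, num, map_sum, ← sum_dag_annOf_mul_annOf, single_eq_pFun]

open Matrix in
theorem Nf_eq : L.Nf = secondQuant (∑ R : {R : L.Site // R ∈ L.Λf},
    vecMulVec (L.fFun R.1) (L.fFun R.1)) := by
  simp only [Nf, num, map_sum, ← sum_dag_annOf_mul_annOf, single_eq_fFun]

theorem Np_add_Nf : L.Np + L.Nf = ∑ x : L.Mode, dag (ann x) * ann x := by
  rw [Fintype.sum_prod_type, Fintype.sum_sum_type, add_comm, Fintype.sum_prod_type]
  rfl

open Matrix in
theorem isSymm_hopF_matrix : (∑ R ∈ L.Λf, ∑ i : Fin 6,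
    vecMulVec (L.fFun (R + (wVec i : L.Site))) (L.fFun R)).IsSymm := by
  classical
  -- The transpose amounts to traversing each bond in the opposite direction.
  have hw : ∀ i : Fin 6, wVec (i + 3) = -wVec i := by decide
  ext o o'
  simp only [transpose_apply, Matrix.sum_apply, vecMulVec_apply]
  have key : ∀ Q Q' : L.Label, ∑ R ∈ L.Λf, ∑ i : Fin 6,
      (if Q'.1 = R + (wVec i : L.Site) then (1 : ℝ) else 0) * (if Q.1 = R then 1 else 0) =
      ∑ i : Fin 6, if Q'.1 = Q.1 + (wVec i : L.Site) then (1 : ℝ) else 0 := by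
    intro Q Q'
    rw [Finset.sum_eq_single Q.1]
    · simp
    · intro R _ hR
      simp [Ne.symm hR]
    · intro h
      exact absurd Q.2 h
  rcases o with Q | Q <;> rcases o' with Q' | Q' <;> simp only [fFun, mul_zero, zero_mul]
  rw [key, key]
  rw [← Equiv.sum_comp (Equiv.addRight (3 : Fin 6))]
  refine Finset.sum_congr rfl fun i _ => ?_
  simp only [Equiv.coe_addRight, hw, QuotientAddGroup.mk_neg, ← sub_eq_add_neg,
    eq_sub_iff_add_eq]
  congr 1
  exact propext eq_comm

open Matrix in
/-- The one-particle part of the Hamiltonian is the flat-band energy times the particle number plus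
a sum of squares of the operators that measure the deviation from the flat band. -/
theorem one_body_identity (K : Couplings) (htf : K.tf ≠ 0) (htfp : K.tfp ≠ 0) :
    -L.HK K + (K.μp : ℂ) • L.Np + (K.μfc : ℂ) • L.Nf =
      (K.flatEnergy : ℂ) • (L.Np + L.Nf)
      + ((K.tfp ^ 2 / K.tf - 3 * K.tp : ℝ) : ℂ) • ∑ r : {r : L.Site // r ∈ L.Λp}, ∑ d : Fin 2,
          ∑ σ, dag (annOf σ (L.devFun K (r, d))) * annOf σ (L.devFun K (r, d))
      + (K.tp : ℂ) • ∑ r ∈ L.bondSites, ∑ k, ∑ σ,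
          dag (annOf σ (L.devDirFun K r (vHat k)
            - L.devDirFun K (r + (vVec k : L.Site)) (vHat k))) *
          annOf σ (L.devDirFun K r (vHat k)
            - L.devDirFun K (r + (vVec k : L.Site)) (vHat k)) := by
  have hF : ∀ x, ∀ R, R ∉ L.Λf → L.fPart x R = 0 := fun x R hR => dif_neg hR
  have hY : ∀ x, ∀ r, r ∉ L.Λp → L.pPart x r = 0 := fun x r hr => funext fun d => dif_neg hr
  rw [HK, hopP_eq, hopF_eq, hopFP_eq, Np_eq, Nf_eq]
  simp only [sum_dag_annOf_mul_annOf, ← map_sum, ← secondQuant_smul, ← map_add, ← map_neg]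
  congr 1
  have hsq : ∀ g : L.Orb → ℝ, (vecMulVec g g).IsSymm := fun g => transpose_vecMulVec _ _
  have hsq2 : ∀ g h : L.Orb → ℝ, (vecMulVec g h + vecMulVec h g).IsSymm := fun g h => by
    rw [IsSymm, transpose_add, transpose_vecMulVec, transpose_vecMulVec, add_comm]
  have hsum : ∀ {ι : Type} (s : Finset ι) (A : ι → Matrix L.Orb L.Orb ℝ),
      (∀ i, (A i).IsSymm) → (∑ i ∈ s, A i).IsSymm := fun s A h => by
    rw [IsSymm, transpose_sum]
    exact Finset.sum_congr rfl fun i _ => h i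
  refine eq_of_quadratic_form_eq ?_ ?_ fun x => ?_
  · refine (((((hsum _ _ fun r => hsum _ _ fun k => ?_).smul _).add
      ((L.isSymm_hopF_matrix).smul _)).add
      ((hsum _ _ fun r => hsum _ _ fun k => (hsq2 _ _).smul _).smul _)).neg.add
      ((hsum _ _ fun r => hsum _ _ fun d => hsq _).smul _)).add
      ((hsum _ _ fun r => hsq _).smul _)
    exact hsq2 _ _
  · exact ((((hsum _ _ fun r => hsum _ _ fun d => hsq _).add (hsum _ _ fun r => hsq _)).smul _).add
      ((hsum _ _ fun r => hsum _ _ fun d => hsq _).smul _)).add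
      ((hsum _ _ fun r => hsum _ _ fun k => hsq _).smul _)
  · have hid := L.one_particle_identity K htf htfp (hF x) (hY x) (fun r => rfl)
    have hZ : ∀ r : {r : L.Site // r ∈ L.Λp}, ∀ d, L.devFun K (r, d) ⬝ᵥ x =
        (L.pPart x r.1 - (K.tf / K.tfp) • L.plaquetteField (L.fPart x) r.1) d := by
      intro r d
      have := L.devDirFun_dotProduct K r.1 (Pi.single d 1) x
      rw [single_one_dotProduct, devDirFun, dif_pos r.2] at this
      rw [← this]
      congr 1
      rw [Finset.sum_eq_single d]
      · simp
      · intro d' _ hd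
        simp [hd]
      · simp
    simp only [add_mulVec, neg_mulVec, smul_mulVec, sum_mulVec, dotProduct_add, dotProduct_neg,
      dotProduct_smul, dotProduct_sum, vecMulVec_quadratic, fFun_dotProduct, pFun_dotProduct,
      smul_eq_mul, sub_dotProduct, devDirFun_dotProduct, hZ, single_one_dotProduct]
    have e1 : ∑ r : {r : L.Site // r ∈ L.Λp}, ∑ d : Fin 2, L.pPart x r.1 d * L.pPart x r.1 d =
        ∑ r ∈ L.Λp, L.pPart x r ⬝ᵥ L.pPart x r := Finset.sum_coe_sort L.Λp
          (fun r => L.pPart x r ⬝ᵥ L.pPart x r)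
    have e2 : ∑ R : {R : L.Site // R ∈ L.Λf}, L.fPart x R.1 * L.fPart x R.1 =
        ∑ R ∈ L.Λf, L.fPart x R ^ 2 := by
      simp only [← pow_two]
      exact Finset.sum_coe_sort L.Λf (fun R => L.fPart x R ^ 2)
    have e3 : ∑ r : {r : L.Site // r ∈ L.Λp}, ∑ d : Fin 2,
        (L.pPart x r.1 - (K.tf / K.tfp) • L.plaquetteField (L.fPart x) r.1) d *
        (L.pPart x r.1 - (K.tf / K.tfp) • L.plaquetteField (L.fPart x) r.1) d =
        ∑ r ∈ L.Λp, (L.pPart x r - (K.tf / K.tfp) • L.plaquetteField (L.fPart x) r) ⬝ᵥ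
          (L.pPart x r - (K.tf / K.tfp) • L.plaquetteField (L.fPart x) r) :=
      Finset.sum_coe_sort L.Λp (fun r =>
        (L.pPart x r - (K.tf / K.tfp) • L.plaquetteField (L.fPart x) r) ⬝ᵥ
          (L.pPart x r - (K.tf / K.tfp) • L.plaquetteField (L.fPart x) r))
    rw [e1, e2, e3]
    simp only [← pow_two]
    rw [← hid]
    have c1 : ∀ a b : ℝ, a * b + b * a = 2 * (b * a) := fun a b => by ring
    have c2 : ∀ s a b : ℝ, s * (2 * (a * b)) = 2 * (s * (b * a)) := fun s a b => by ring
    simp only [c1, c2, ← Finset.mul_sum]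
    ring

end TwoLayer
end FlatBand

/-! ### The Hamiltonian as a constant plus a nonnegative operator -/

namespace FlatBand

open scoped InnerProductSpace

section PosWithKernel

variable {M : Type*} [Fintype M]

/-- The operator `Q` is nonnegative, and `P` describes its kernel, which is also the set of states
with vanishing expectation value. -/
def PosWithKernel (Q : Op M) (P : Fock M → Prop) : Prop :=
  ∀ ψ : Fock M, 0 ≤ (⟪ψ, Q ψ⟫_ℂ).re ∧ ((⟪ψ, Q ψ⟫_ℂ).re = 0 → P ψ) ∧ (P ψ → Q ψ = 0)

namespace PosWithKernel

theorem dag_mul_self (X : Op M) : PosWithKernel (dag X * X) (fun ψ => X ψ = 0) := by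
  intro ψ
  rw [inner_dag_mul_self, Complex.ofReal_re]
  refine ⟨by positivity, fun h => ?_, fun h => by rw [Module.End.mul_apply, h, map_zero]⟩
  simpa using h

theorem smul {Q : Op M} {P : Fock M → Prop} (h : PosWithKernel Q P) {a : ℝ} (ha : 0 < a) :
    PosWithKernel ((a : ℂ) • Q) P := by
  intro ψ
  obtain ⟨h1, h2, h3⟩ := h ψ
  rw [LinearMap.smul_apply, inner_smul_right, Complex.re_ofReal_mul]
  refine ⟨by positivity, fun h => h2 ?_, fun h => by rw [h3 h, smul_zero]⟩
  exact (mul_eq_zero.mp h).resolve_left ha.ne'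

theorem add {Q Q' : Op M} {P P' : Fock M → Prop} (h : PosWithKernel Q P)
    (h' : PosWithKernel Q' P') : PosWithKernel (Q + Q') (fun ψ => P ψ ∧ P' ψ) := by
  intro ψ
  obtain ⟨h1, h2, h3⟩ := h ψ
  obtain ⟨h1', h2', h3'⟩ := h' ψ
  rw [LinearMap.add_apply, inner_add_right, Complex.add_re]
  refine ⟨by positivity, fun h => ⟨h2 (by linarith), h2' (by linarith)⟩, fun h => ?_⟩
  rw [h3 h.1, h3' h.2, add_zero]

theorem sum {ι : Type*} {s : Finset ι} {Q : ι → Op M} {P : ι → Fock M → Prop}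
    (h : ∀ i, PosWithKernel (Q i) (P i)) :
    PosWithKernel (∑ i ∈ s, Q i) (fun ψ => ∀ i ∈ s, P i ψ) := by
  intro ψ
  rw [LinearMap.sum_apply, inner_sum, Complex.re_sum]
  refine ⟨Finset.sum_nonneg fun i _ => (h i ψ).1, fun h0 i hi => (h i ψ).2.1 ?_, fun hP => ?_⟩
  · exact (Finset.sum_eq_zero_iff_of_nonneg fun i _ => (h i ψ).1).mp h0 i hi
  · exact Finset.sum_eq_zero fun i hi => (h i ψ).2.2 (hP i hi)

/-- If `H` acts on the `N`-particle states as a constant plus a nonnegative operator with a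
nontrivial kernel, this kernel is the ground state space. -/
theorem isGroundStateSpace {Q : Op M} {P : Fock M → Prop} (hQ : PosWithKernel Q P) {H : Op M}
    {N : ℕ} {E : ℝ} (hH : ∀ ψ ∈ sector (M := M) N, H ψ = (E : ℂ) • ψ + Q ψ)
    {V : Submodule ℂ (Fock M)} (hV : ∀ ψ, ψ ∈ V ↔ ψ ∈ sector (M := M) N ∧ P ψ)
    (hne : ∃ ψ ∈ V, ψ ≠ 0) : IsGroundStateSpace H N V := by
  have hP : ∀ ψ ∈ sector (M := M) N, P ψ ↔ H ψ = (E : ℂ) • ψ := by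
    intro ψ hψ
    rw [hH ψ hψ]
    refine ⟨fun h => by rw [(hQ ψ).2.2 h, add_zero], fun h => (hQ ψ).2.1 ?_⟩
    rw [add_eq_left.mp h, inner_zero_right, Complex.zero_re]
  refine ⟨E, ⟨?_, ?_⟩, fun ψ => ?_⟩
  · obtain ⟨ψ, hψ, h0⟩ := hne
    obtain ⟨hs, hp⟩ := (hV ψ).mp hψ
    exact ⟨ψ, hs, h0, (hP ψ hs).mp hp⟩
  · rintro e ⟨ψ, hs, h0, he⟩
    have h1 : Q ψ = ((e - E : ℝ) : ℂ) • ψ := by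
      rw [hH ψ hs] at he
      rw [Complex.ofReal_sub, sub_smul, ← he, add_sub_cancel_left]
    have h2 := (hQ ψ).1
    rw [h1, inner_smul_right, Complex.re_ofReal_mul, inner_self_eq_norm_sq_to_K] at h2
    have h3 : ((((‖ψ‖ : ℝ) : ℂ) ^ 2)).re = ‖ψ‖ ^ 2 := by
      rw [← Complex.ofReal_pow, Complex.ofReal_re]
    have h4 : 0 ≤ (e - E) * ‖ψ‖ ^ 2 := by rw [← h3]; exact h2
    have h5 : 0 < ‖ψ‖ ^ 2 := by positivity
    have := nonneg_of_mul_nonneg_left h4 h5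
    linarith
  · rw [hV]
    exact and_congr_right fun hs => hP ψ hs

end PosWithKernel

end PosWithKernel

namespace TwoLayer

variable (L : TwoLayer)

/-- The operator that removes a pair of electrons of opposite spin from the orbital `o`. -/
noncomputable def pair (o : L.Orb) : Op L.Mode := L.c 1 o * L.c 0 o

/-- The operator that removes a singlet formed between the orbitals `p_x` and `p_y` at `r`. -/
noncomputable def hundSinglet (r : {r : L.Site // r ∈ L.Λp}) : Op L.Mode :=
  L.c 1 (Sum.inr (r, 1)) * L.c 0 (Sum.inr (r, 0)) - L.c 0 (Sum.inr (r, 1)) * L.c 1 (Sum.inr (r, 0))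

/-- The annihilator, with spin `σ`, of the deviation from the flat band in the `p` orbital `o`. -/
noncomputable def dev (K : Couplings) (σ : Fin 2) (o : {r : L.Site // r ∈ L.Λp} × Fin 2) :
    Op L.Mode := annOf σ (L.devFun K o)

theorem hubbard_term (o : L.Orb) :
    (L.num o 0 - (1 / 2 : ℂ) • (1 : Op L.Mode)) * (L.num o 1 - (1 / 2 : ℂ) • (1 : Op L.Mode)) =
      dag (L.pair o) * L.pair o - (1 / 2 : ℂ) • ∑ σ, L.num o σ + (1 / 4 : ℂ) • 1 := by
  have : L.num o 0 * L.num o 1 = dag (L.pair o) * L.pair o :=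
    number_mul_number (by simp)
  rw [← this, Fin.sum_univ_two]
  simp only [sub_mul, mul_sub, smul_mul_assoc, mul_smul_comm, one_mul, mul_one]
  module

theorem HU_eq (K : Couplings) : L.HU K =
    (K.Up : ℂ) • ∑ r : {r : L.Site // r ∈ L.Λp}, ∑ d : Fin 2,
        dag (L.pair (Sum.inr (r, d))) * L.pair (Sum.inr (r, d))
      + (K.Uf : ℂ) • ∑ R : {R : L.Site // R ∈ L.Λf}, dag (L.pair (Sum.inl R)) * L.pair (Sum.inl R)
      - ((K.Up / 2 : ℝ) : ℂ) • L.Np - ((K.Uf / 2 : ℝ) : ℂ) • L.Nf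
      + ((K.Up * L.Λp.card / 2 + K.Uf * L.Λf.card / 4 : ℝ) : ℂ) • 1 := by
  simp only [HU, hubbard_term, Finset.sum_add_distrib, Finset.sum_sub_distrib, ← Finset.smul_sum,
    Np, Nf, Finset.sum_const, Finset.card_univ, Fintype.card_fin, Fintype.card_coe]
  push_cast
  module

theorem hund_term (r : {r : L.Site // r ∈ L.Λp}) :
    ∑ i : Fin 3, L.spin (Sum.inr (r, 0)) i * L.spin (Sum.inr (r, 1)) i
      - (1 / 4 : ℂ) • ((∑ σ : Fin 2, L.num (Sum.inr (r, 0)) σ) *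
          ∑ σ : Fin 2, L.num (Sum.inr (r, 1)) σ) =
      -((1 / 2 : ℂ) • (dag (L.hundSinglet r) * L.hundSinglet r)) := by
  have h : ∀ μ ν μ' ν' : Fin 2,
      (((Sum.inr (r, 0), μ) : L.Mode) ≠ (Sum.inr (r, 1), ν)) := by
    intro μ ν _ _ h
    simp at h
  have hs := spin_dot_spin (fun μ ν => dag (L.c μ (Sum.inr (r, 0))) * L.c ν (Sum.inr (r, 0)))
    (fun μ ν => dag (L.c μ (Sum.inr (r, 1))) * L.c ν (Sum.inr (r, 1)))
  simp only [spin, num]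
  rw [hs]
  simp only [c]
  rw [hop_mul_hop (h _ _ 0 0), hop_mul_hop (h _ _ 0 0), hop_mul_hop (h _ _ 0 0),
    hop_mul_hop (h _ _ 0 0)]
  simp only [hundSinglet, c, dag_sub, dag_mul, sub_mul, mul_sub]
  congr 2
  abel

theorem HJ_eq (K : Couplings) : L.HJ K = ((K.J / 2 : ℝ) : ℂ) •
    ∑ r : {r : L.Site // r ∈ L.Λp}, dag (L.hundSinglet r) * L.hundSinglet r := by
  simp only [HJ, hund_term, Finset.sum_neg_distrib, ← Finset.smul_sum]
  push_cast
  module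

/-- The ground state energy in the `N`-particle sector. -/
noncomputable def groundEnergy (K : Couplings) (N : ℕ) : ℝ :=
  K.Up * L.Λp.card / 2 + K.Uf * L.Λf.card / 4 + (K.flatEnergy - K.Up / 2 - K.J / 2) * N

/-- The nonnegative part of the Hamiltonian: the excitation energies out of the flat band and the
interaction energies of doubly occupied orbitals and of inter-orbital singlets. -/
noncomputable def excess (K : Couplings) : Op L.Mode :=
  ((K.tfp ^ 2 / K.tf - 3 * K.tp : ℝ) : ℂ) • ∑ r : {r : L.Site // r ∈ L.Λp}, ∑ d : Fin 2,
      ∑ σ, dag (L.dev K σ (r, d)) * L.dev K σ (r, d)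
    + (K.tp : ℂ) • ∑ r ∈ L.bondSites, ∑ k, ∑ σ,
      dag (annOf σ (L.devDirFun K r (vHat k)
        - L.devDirFun K (r + (vVec k : L.Site)) (vHat k))) *
      annOf σ (L.devDirFun K r (vHat k)
        - L.devDirFun K (r + (vVec k : L.Site)) (vHat k))
    + (K.Up : ℂ) • ∑ r : {r : L.Site // r ∈ L.Λp}, ∑ d : Fin 2,
      dag (L.pair (Sum.inr (r, d))) * L.pair (Sum.inr (r, d))
    + (K.Uf : ℂ) • ∑ R : {R : L.Site // R ∈ L.Λf}, dag (L.pair (Sum.inl R)) * L.pair (Sum.inl R)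
    + ((K.J / 2 : ℝ) : ℂ) • ∑ r : {r : L.Site // r ∈ L.Λp},
      dag (L.hundSinglet r) * L.hundSinglet r

/-- At the given value of `μ_f`, the shifts of the orbital energies by the interactions are the same
for both layers, so that they only contribute a constant on the `N`-particle states. -/
theorem Hph_apply (K : Couplings) (htf : K.tf ≠ 0) (htfp : K.tfp ≠ 0)
    (hμ : K.μf = K.μfc + K.Uf / 2 - K.Up / 2 - K.J / 2) {N : ℕ} {ψ : Fock L.Mode}
    (hψ : ψ ∈ sector (M := L.Mode) N) :
    L.Hph K ψ = (L.groundEnergy K N : ℂ) • ψ + L.excess K ψ := by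
  have h1 : L.Hph K = L.excess K
      + ((K.flatEnergy - K.Up / 2 - K.J / 2 : ℝ) : ℂ) • (L.Np + L.Nf)
      + ((K.Up * L.Λp.card / 2 + K.Uf * L.Λf.card / 4 : ℝ) : ℂ) • 1 := by
    have hK := L.one_body_identity K htf htfp
    rw [Hph, HU_eq, HJ_eq, Hμ, hμ, excess]
    simp only [dev]
    rw [add_assoc, ← eq_sub_iff_add_eq] at hK
    rw [hK]
    push_cast
    module
  rw [h1, Np_add_Nf]
  simp only [LinearMap.add_apply, LinearMap.smul_apply, sum_number_apply hψ, Module.End.one_apply,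
    groundEnergy]
  push_cast
  module

/-- The conditions on a state of vanishing excess energy: no component outside of the flat band, no
doubly occupied orbital, and no singlet on the two orbitals of a `p` site. -/
def IsUnfrustrated (K : Couplings) (ψ : Fock L.Mode) : Prop :=
  (∀ o σ, L.dev K σ o ψ = 0) ∧ (∀ o, L.pair o ψ = 0) ∧ ∀ r, L.hundSinglet r ψ = 0

/-- The bond terms of the excess energy need not appear in `IsUnfrustrated`, since they are made of
the operators `dev`. -/
theorem posWithKernel_excess (K : Couplings) (htp : 0 < K.tp) (htf : 0 < K.tf)
    (hUp : 0 < K.Up) (hUf : 0 < K.Uf) (hJ : 0 < K.J) (hgap : 3 * K.tp * K.tf < K.tfp ^ 2) :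
    PosWithKernel (L.excess K) (L.IsUnfrustrated K) := by
  have hs : 0 < K.tfp ^ 2 / K.tf - 3 * K.tp := by
    rw [sub_pos, lt_div_iff₀ htf]
    exact hgap
  have key : PosWithKernel (L.excess K) _ :=
    ((((PosWithKernel.sum fun r => PosWithKernel.sum fun d => PosWithKernel.sum fun σ =>
      PosWithKernel.dag_mul_self (L.dev K σ (r, d))).smul hs).add
    ((PosWithKernel.sum fun r => PosWithKernel.sum fun k => PosWithKernel.sum fun σ =>
      PosWithKernel.dag_mul_self _).smul htp)).add
    ((PosWithKernel.sum fun r => PosWithKernel.sum fun d =>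
      PosWithKernel.dag_mul_self (L.pair (Sum.inr (r, d)))).smul hUp)).add
    ((PosWithKernel.sum fun R => PosWithKernel.dag_mul_self (L.pair (Sum.inl R))).smul hUf)
    |>.add ((PosWithKernel.sum fun r => PosWithKernel.dag_mul_self (L.hundSinglet r)).smul
      (half_pos hJ))
  refine fun ψ => ⟨(key ψ).1, fun h => ?_, fun h => (key ψ).2.2 ?_⟩
  · obtain ⟨⟨⟨⟨h1, -⟩, h3⟩, h4⟩, h5⟩ := (key ψ).2.1 h
    refine ⟨fun o σ => h1 o.1 (Finset.mem_univ _) o.2 (Finset.mem_univ _) σ (Finset.mem_univ _),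
      ?_, fun r => h5 r (Finset.mem_univ _)⟩
    rintro (R | o)
    · exact h4 R (Finset.mem_univ _)
    · exact h3 o.1 (Finset.mem_univ _) o.2 (Finset.mem_univ _)
  · obtain ⟨h1, h2, h3⟩ := h
    refine ⟨⟨⟨⟨fun r _ d _ σ _ => h1 _ _, fun r _ k _ σ _ => ?_⟩, fun r _ d _ => h2 _⟩,
      fun R _ => h2 _⟩, fun r _ => h3 _⟩
    have hd : ∀ r e, annOf σ (L.devDirFun K r e) ψ = 0 := by
      intro r e
      unfold devDirFun
      split_ifs with h
      · rw [annOf_sum, LinearMap.sum_apply]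
        refine Finset.sum_eq_zero fun d _ => ?_
        rw [annOf_smul, LinearMap.smul_apply]
        exact (congrArg _ (h1 (⟨r, h⟩, d) σ)).trans (smul_zero _)
      · rw [annOf_zero, LinearMap.zero_apply]
    rw [annOf_sub, LinearMap.sub_apply, hd, hd, sub_zero]

end TwoLayer
end FlatBand

/-! ### Unfrustrated states in terms of the localized states -/

namespace FlatBand

namespace TwoLayer

variable (L : TwoLayer)

/-- The six corners of a plaquette are distinct. -/
theorem corner_injective (R : L.Site) {i j : Fin 6}
    (h : R + (uVec i : L.Site) = R + (uVec j : L.Site)) : i = j := by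
  by_contra hij
  have h1 : (uVec i : L.Site) = uVec j := add_left_cancel h
  have hc : colour (uVec i) = colour (uVec j) := by
    rw [← L.siteColour_coe, h1, L.siteColour_coe]
  obtain ⟨k, hk⟩ := exists_wVec_eq_uVec_sub hij hc
  refine L.wVec_not_mem k ?_
  rw [hk, ← QuotientAddGroup.eq_zero_iff, QuotientAddGroup.mk_sub, h1, sub_self]

theorem cornerAmp_corner {R r : L.Site} {i : Fin 6} (h : R + (uVec i : L.Site) = r) (d : Fin 2) :
    L.cornerAmp R r d = (-1) ^ (i : ℕ) * uPerp i d := by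
  rw [cornerAmp, Finset.sum_eq_single i]
  · rw [if_pos h]
  · intro j _ hj
    rw [if_neg]
    rw [← h]
    exact fun e => hj (L.corner_injective R e)
  · simp

theorem exists_corner_of_cornerAmp_ne_zero {R r : L.Site} {d : Fin 2}
    (h : L.cornerAmp R r d ≠ 0) : ∃ i, R + (uVec i : L.Site) = r := by
  by_contra hn
  push Not at hn
  exact h (Finset.sum_eq_zero fun i _ => if_neg (hn i))

/-- If two different plaquettes share the corner `r`, some direction at `r` is seen by the localized
states of these two plaquettes, and of no other plaquette. -/
theorem exists_direction {R R' : L.Label} (hne : R ≠ R') {r : L.Site}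
    (h : ∃ i, R.1 + (uVec i : L.Site) = r) (h' : ∃ i, R'.1 + (uVec i : L.Site) = r) :
    ∃ e : Fin 2 → ℝ, e ⬝ᵥ L.cornerAmp R.1 r ≠ 0 ∧ e ⬝ᵥ L.cornerAmp R'.1 r ≠ 0 ∧
      ∀ Q : L.Label, Q ≠ R → Q ≠ R' → e ⬝ᵥ L.cornerAmp Q.1 r = 0 := by
  obtain ⟨i, hi⟩ := h
  obtain ⟨j, hj⟩ := h'
  have hcol : ∀ (Q : L.Label) k, Q.1 + (uVec k : L.Site) = r →
      colour (uVec k) = L.siteColour r := by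
    intro Q k hk
    rw [← hk, map_add, L.siteColour_of_mem_Λf Q.2, zero_add, siteColour_coe]
  have hval : ∀ (Q : L.Label) k (e : Fin 2 → ℝ), Q.1 + (uVec k : L.Site) = r →
      e ⬝ᵥ L.cornerAmp Q.1 r = (-1) ^ (k : ℕ) * (e ⬝ᵥ uPerp k) := by
    intro Q k e hk
    have : L.cornerAmp Q.1 r = ((-1) ^ (k : ℕ) : ℝ) • uPerp k :=
      funext fun d => L.cornerAmp_corner hk d
    rw [this, dotProduct_smul, smul_eq_mul]
  have huniq : ∀ (Q Q' : L.Label) k, Q.1 + (uVec k : L.Site) = r → Q'.1 + (uVec k : L.Site) = r →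
      Q = Q' := fun Q Q' k hk hk' => Subtype.ext (add_right_cancel (hk.trans hk'.symm))
  have hij : i ≠ j := by
    rintro rfl
    exact hne (huniq R R' i hi hj)
  obtain ⟨e, h1, h2, h3⟩ := exists_detecting_direction hij ((hcol R i hi).trans (hcol R' j hj).symm)
  refine ⟨e, ?_, ?_, fun Q hQ hQ' => ?_⟩
  · rw [hval R i e hi]
    exact mul_ne_zero (by simp) h1
  · rw [hval R' j e hj]
    exact mul_ne_zero (by simp) h2
  · by_cases hk : ∃ k, Q.1 + (uVec k : L.Site) = r
    · obtain ⟨k, hk⟩ := hk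
      rw [hval Q k e hk, h3 k ((hcol Q k hk).trans (hcol R i hi).symm) ?_ ?_, mul_zero]
      · rintro rfl; exact hQ (huniq _ _ _ hk hi)
      · rintro rfl; exact hQ' (huniq _ _ _ hk hj)
    · have : L.cornerAmp Q.1 r = 0 := by
        funext d
        by_contra h0
        exact hk (L.exists_corner_of_cornerAmp_ne_zero h0)
      rw [this, dotProduct_zero]

theorem φ_inl (K : Couplings) (htfp : 0 < K.tfp) (R R' : L.Label) :
    L.φ K R (Sum.inl R') ≠ 0 ↔ R' = R := by
  have : 0 < √(6 * K.tf ^ 2 + K.tfp ^ 2) := Real.sqrt_pos.mpr (by positivity)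
  rw [φ]
  split_ifs with h
  · simp [h, htfp.ne', this.ne']
  · simp [h]

theorem φ_inr (K : Couplings) (htf : 0 < K.tf) (R : L.Label)
    (o : {r : L.Site // r ∈ L.Λp} × Fin 2) :
    L.φ K R (Sum.inr o) ≠ 0 ↔ L.cornerAmp R.1 o.1.1 o.2 ≠ 0 := by
  have : 0 < √(6 * K.tf ^ 2 + K.tfp ^ 2) := Real.sqrt_pos.mpr (by positivity)
  obtain ⟨r, d⟩ := o
  show K.tf / √(6 * K.tf ^ 2 + K.tfp ^ 2) * L.cornerAmp R.1 r.1 d ≠ 0 ↔ _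
  simp [htf.ne', this.ne']

theorem overlap_refl (K : Couplings) (htfp : 0 < K.tfp) (R : L.Label) : L.Overlap K R R :=
  ⟨Sum.inl R, by simp [L.φ_inl K htfp]⟩

theorem overlap_symm {K : Couplings} {R R' : L.Label} (h : L.Overlap K R R') :
    L.Overlap K R' R := by
  obtain ⟨o, h1, h2⟩ := h
  exact ⟨o, h2, h1⟩

/-- On a vertex site, the localized states are nonzero in the `p_y` orbital, so that plaquettes with
a common corner always overlap. -/
theorem overlap_of_cornerAmp {K : Couplings} (htf : 0 < K.tf) {R R' : L.Label}
    {r : {r : L.Site // r ∈ L.Λp}} {d d' : Fin 2} (h : L.cornerAmp R.1 r.1 d ≠ 0)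
    (h' : L.cornerAmp R'.1 r.1 d' ≠ 0) : L.Overlap K R R' := by
  obtain ⟨i, hi⟩ := L.exists_corner_of_cornerAmp_ne_zero h
  obtain ⟨j, hj⟩ := L.exists_corner_of_cornerAmp_ne_zero h'
  refine ⟨Sum.inr (r, 1), ?_, ?_⟩
  · rw [L.φ_inr K htf, L.cornerAmp_corner hi]
    exact mul_ne_zero (by simp) (uPerp_one_ne_zero i)
  · rw [L.φ_inr K htf, L.cornerAmp_corner hj]
    exact mul_ne_zero (by simp) (uPerp_one_ne_zero j)

theorem c_mul_c (σ τ : Fin 2) (o o' : L.Orb) : L.c σ o * L.c τ o' = -(L.c τ o' * L.c σ o) :=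
  ann_mul_ann _ _

/-- The operator that removes a singlet formed between the `f` orbitals at `R` and `R'`. -/
noncomputable def labelSinglet (R R' : L.Label) : Op L.Mode :=
  L.c 0 (Sum.inl R) * L.c 1 (Sum.inl R') - L.c 1 (Sum.inl R) * L.c 0 (Sum.inl R')

theorem labelSinglet_comm (R R' : L.Label) : L.labelSinglet R R' = L.labelSinglet R' R := by
  rw [labelSinglet, labelSinglet, L.c_mul_c 0 1 (Sum.inl R) (Sum.inl R'),
    L.c_mul_c 1 0 (Sum.inl R) (Sum.inl R')]
  abel

/-- The operator that removes two electrons in a spin singlet, from the `p` orbitals `d`, `d'` at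
the site `r`. -/
noncomputable def siteSinglet (r : {r : L.Site // r ∈ L.Λp}) (d d' : Fin 2) : Op L.Mode :=
  L.c 0 (Sum.inr (r, d)) * L.c 1 (Sum.inr (r, d')) - L.c 1 (Sum.inr (r, d)) * L.c 0 (Sum.inr (r, d'))

theorem labelSinglet_self (R : L.Label) :
    L.labelSinglet R R = (-2 : ℂ) • L.pair (Sum.inl R) := by
  rw [labelSinglet, pair, L.c_mul_c 0 1]
  module

theorem siteSinglet_self (r : {r : L.Site // r ∈ L.Λp}) (d : Fin 2) :
    L.siteSinglet r d d = (-2 : ℂ) • L.pair (Sum.inr (r, d)) := by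
  rw [siteSinglet, pair, L.c_mul_c 0 1]
  module

theorem siteSinglet_zero_one (r : {r : L.Site // r ∈ L.Λp}) :
    L.siteSinglet r 0 1 = -L.hundSinglet r := by
  rw [siteSinglet, hundSinglet, L.c_mul_c 0 1 (Sum.inr (r, 0)), L.c_mul_c 1 0 (Sum.inr (r, 0))]
  abel

theorem siteSinglet_one_zero (r : {r : L.Site // r ∈ L.Λp}) :
    L.siteSinglet r 1 0 = -L.hundSinglet r := by
  rw [siteSinglet, hundSinglet]
  abel

theorem dev_eq (K : Couplings) (σ : Fin 2) (o : {r : L.Site // r ∈ L.Λp} × Fin 2) :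
    L.dev K σ o = L.c σ (Sum.inr o) -
      ∑ R : L.Label, ((K.tf / K.tfp * L.cornerAmp R.1 o.1.1 o.2 : ℝ) : ℂ) • L.c σ (Sum.inl R) := by
  classical
  rw [dev, annOf, Fintype.sum_sum_type, Finset.sum_eq_single (a := o) (s := (Finset.univ :
    Finset ({r : L.Site // r ∈ L.Λp} × Fin 2)))]
  · simp [devFun, c, add_comm, sub_eq_add_neg]
  · intro o' _ h
    simp [devFun, h]
  · simp

theorem dev_mul_c (K : Couplings) (σ τ : Fin 2) (o : {r : L.Site // r ∈ L.Λp} × Fin 2)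
    (o' : L.Orb) : L.dev K σ o * L.c τ o' = -(L.c τ o' * L.dev K σ o) :=
  annOf_mul_ann _ _ _

section Flat

variable {K : Couplings} {ψ : Fock L.Mode}

/-- On a state in the flat band, the `p` annihilators act as combinations of `f` annihilators. -/
theorem c_inr_apply (hψ : ∀ o σ, L.dev K σ o ψ = 0) (σ : Fin 2)
    (o : {r : L.Site // r ∈ L.Λp} × Fin 2) :
    L.c σ (Sum.inr o) ψ =
      ∑ R : L.Label, ((K.tf / K.tfp * L.cornerAmp R.1 o.1.1 o.2 : ℝ) : ℂ) •
        L.c σ (Sum.inl R) ψ := by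
  have := hψ o σ
  rw [dev_eq, LinearMap.sub_apply, sub_eq_zero] at this
  rw [this]
  simp [LinearMap.sum_apply]

theorem dev_c_apply (hψ : ∀ o σ, L.dev K σ o ψ = 0) (τ : Fin 2) (o' : L.Orb)
    (o : {r : L.Site // r ∈ L.Λp} × Fin 2) (σ : Fin 2) : L.dev K σ o (L.c τ o' ψ) = 0 := by
  rw [← Module.End.mul_apply, dev_mul_c, LinearMap.neg_apply, Module.End.mul_apply, hψ, map_zero,
    neg_zero]

theorem siteSinglet_apply (hψ : ∀ o σ, L.dev K σ o ψ = 0) (r : {r : L.Site // r ∈ L.Λp})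
    (d d' : Fin 2) :
    L.siteSinglet r d d' ψ = ∑ R : L.Label, ∑ R' : L.Label,
      ((K.tf / K.tfp * L.cornerAmp R.1 r.1 d * (K.tf / K.tfp * L.cornerAmp R'.1 r.1 d') : ℝ) : ℂ) •
        L.labelSinglet R R' ψ := by
  have key : ∀ σ τ, L.c σ (Sum.inr (r, d)) (L.c τ (Sum.inr (r, d')) ψ) =
      ∑ R : L.Label, ∑ R' : L.Label,
      ((K.tf / K.tfp * L.cornerAmp R.1 r.1 d * (K.tf / K.tfp * L.cornerAmp R'.1 r.1 d') : ℝ) : ℂ) •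
        L.c σ (Sum.inl R) (L.c τ (Sum.inl R') ψ) := by
    intro σ τ
    rw [L.c_inr_apply (L.dev_c_apply hψ τ _)]
    refine Finset.sum_congr rfl fun R _ => ?_
    rw [L.c_inr_apply hψ, map_sum, Finset.smul_sum]
    refine Finset.sum_congr rfl fun R' _ => ?_
    rw [map_smul, smul_smul, Complex.ofReal_mul (K.tf / K.tfp * L.cornerAmp R.1 r.1 d)]
  rw [siteSinglet, LinearMap.sub_apply, Module.End.mul_apply, Module.End.mul_apply, key, key,
    ← Finset.sum_sub_distrib]
  refine Finset.sum_congr rfl fun R _ => ?_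
  rw [← Finset.sum_sub_distrib]
  refine Finset.sum_congr rfl fun R' _ => ?_
  rw [← smul_sub]
  rfl

end Flat

/-- The interactions of a state in the flat band vanish if and only if no two electrons on
overlapping (or equal) labels form a singlet. -/
theorem isUnfrustrated_iff (K : Couplings) (htf : 0 < K.tf) (htfp : 0 < K.tfp) (ψ : Fock L.Mode) :
    L.IsUnfrustrated K ψ ↔ (∀ o σ, L.dev K σ o ψ = 0) ∧
      ∀ R R', L.Overlap K R R' → L.labelSinglet R R' ψ = 0 := by
  constructor
  · rintro ⟨hdev, hpair, hhund⟩
    refine ⟨hdev, fun R R' hov => ?_⟩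
    by_cases hne : R = R'
    · rw [← hne, labelSinglet_self, LinearMap.smul_apply, hpair, smul_zero]
    obtain ⟨o, ho, ho'⟩ := hov
    rcases o with Q | ⟨r, d⟩
    · rw [L.φ_inl K htfp] at ho ho'
      exact absurd (ho.symm.trans ho') hne
    rw [L.φ_inr K htf] at ho ho'
    obtain ⟨e, h1, h2, h3⟩ := L.exists_direction hne
      (L.exists_corner_of_cornerAmp_ne_zero ho) (L.exists_corner_of_cornerAmp_ne_zero ho')
    have hsite : ∀ d d', L.siteSinglet r d d' ψ = 0 := by
      intro d d'
      fin_cases d <;> fin_cases d'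
      · show L.siteSinglet r 0 0 ψ = 0
        rw [siteSinglet_self, LinearMap.smul_apply, hpair, smul_zero]
      · show L.siteSinglet r 0 1 ψ = 0
        rw [siteSinglet_zero_one, LinearMap.neg_apply, hhund, neg_zero]
      · show L.siteSinglet r 1 0 ψ = 0
        rw [siteSinglet_one_zero, LinearMap.neg_apply, hhund, neg_zero]
      · show L.siteSinglet r 1 1 ψ = 0
        rw [siteSinglet_self, LinearMap.smul_apply, hpair, smul_zero]
    -- Contract both vector indices of the site singlet with the direction `e`.
    set g : L.Label → ℂ := fun Q => ((K.tf / K.tfp * (e ⬝ᵥ L.cornerAmp Q.1 r.1) : ℝ) : ℂ) with hg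
    have hg0 : ∀ Q, Q ≠ R → Q ≠ R' → g Q = 0 := fun Q hQ hQ' => by
      simp only [hg]
      rw [h3 Q hQ hQ', mul_zero, Complex.ofReal_zero]
    have hgR : g R ≠ 0 := Complex.ofReal_ne_zero.mpr (mul_ne_zero (div_pos htf htfp).ne' h1)
    have hgR' : g R' ≠ 0 := Complex.ofReal_ne_zero.mpr (mul_ne_zero (div_pos htf htfp).ne' h2)
    have hsum : ∑ Q : L.Label, ∑ Q' : L.Label, (g Q * g Q') • L.labelSinglet Q Q' ψ = 0 := by
      calc _ = ∑ d, ∑ d', ((e d * e d' : ℝ) : ℂ) • L.siteSinglet r d d' ψ := by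
            simp only [L.siteSinglet_apply hdev, Finset.smul_sum, smul_smul]
            rw [Finset.sum_comm' (t' := Finset.univ) (s' := fun _ => Finset.univ) (by simp)]
            simp only [Fin.sum_univ_two, ← Finset.sum_add_distrib, ← add_smul]
            rw [Finset.sum_comm]
            refine Finset.sum_congr rfl fun Q _ => Finset.sum_congr rfl fun Q' _ => ?_
            congr 1
            simp only [hg, dotProduct, Fin.sum_univ_two]
            push_cast
            ring
        _ = 0 := by simp [hsite]
    have hsub : ∀ F : L.Label → Fock L.Mode, (∀ Q, Q ≠ R → Q ≠ R' → F Q = 0) →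
        ∑ Q, F Q = F R + F R' := by
      classical
      intro F hF
      rw [← Finset.sum_pair hne]
      refine (Finset.sum_subset (Finset.subset_univ _) fun Q _ hQ => ?_).symm
      simp only [Finset.mem_insert, Finset.mem_singleton, not_or] at hQ
      exact hF Q hQ.1 hQ.2
    have hself : ∀ Q, L.labelSinglet Q Q ψ = 0 := fun Q => by
      rw [labelSinglet_self, LinearMap.smul_apply, hpair, smul_zero]
    rw [hsub _ fun Q hQ hQ' => by simp [hg0 Q hQ hQ'],
      hsub _ fun Q hQ hQ' => by simp [hg0 Q hQ hQ'],
      hsub _ fun Q hQ hQ' => by simp [hg0 Q hQ hQ'], hself, hself, smul_zero, smul_zero,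
      L.labelSinglet_comm R' R, zero_add, add_zero, mul_comm (g R'), ← two_smul ℂ,
      smul_smul] at hsum
    exact (smul_eq_zero.mp hsum).resolve_left (mul_ne_zero two_ne_zero (mul_ne_zero hgR hgR'))
  · rintro ⟨hdev, hlab⟩
    have hsite : ∀ r d d', L.siteSinglet r d d' ψ = 0 := by
      intro r d d'
      rw [L.siteSinglet_apply hdev]
      refine Finset.sum_eq_zero fun R _ => Finset.sum_eq_zero fun R' _ => ?_
      by_cases h : L.cornerAmp R.1 r.1 d = 0
      · simp [h]
      by_cases h' : L.cornerAmp R'.1 r.1 d' = 0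
      · simp [h']
      rw [hlab R R' (L.overlap_of_cornerAmp htf h h'), smul_zero]
    refine ⟨hdev, ?_, fun r => ?_⟩
    · rintro (R | ⟨r, d⟩)
      · have := hlab R R (L.overlap_refl K htfp R)
        rw [labelSinglet_self, LinearMap.smul_apply] at this
        exact (smul_eq_zero.mp this).resolve_left (by norm_num)
      · have := hsite r d d
        rw [siteSinglet_self, LinearMap.smul_apply] at this
        exact (smul_eq_zero.mp this).resolve_left (by norm_num)
    · have := hsite r 0 1
      rwa [siteSinglet_zero_one, LinearMap.neg_apply, neg_eq_zero] at this

end TwoLayer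
end FlatBand

/-! ### Clusters and cluster states -/

namespace FlatBand

namespace TwoLayer

variable (L : TwoLayer)

section Clusters

variable {L} {K : Couplings} {A : Finset L.Label}

theorem mem_cluster {R Q : L.Label} : R ∈ L.cluster K A Q ↔
    R ∈ A ∧ Relation.ReflTransGen (fun P P' => P' ∈ A ∧ L.Overlap K P P') Q R := by
  simp [cluster]

theorem mem_clusters {C : Finset L.Label} :
    C ∈ L.clusters K A ↔ ∃ Q ∈ A, L.cluster K A Q = C := by
  simp [clusters]

theorem subset_of_mem_clusters {C : Finset L.Label} (hC : C ∈ L.clusters K A) : C ⊆ A := by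
  obtain ⟨Q, -, rfl⟩ := mem_clusters.mp hC
  exact fun R hR => (mem_cluster.mp hR).1

theorem mem_cluster_self {R : L.Label} (hR : R ∈ A) : R ∈ L.cluster K A R :=
  mem_cluster.mpr ⟨hR, Relation.ReflTransGen.refl⟩

theorem cluster_mem_clusters {R : L.Label} (hR : R ∈ A) : L.cluster K A R ∈ L.clusters K A :=
  mem_clusters.mpr ⟨R, hR, rfl⟩

theorem mem_of_overlap {C : Finset L.Label} (hC : C ∈ L.clusters K A) {R R' : L.Label}
    (hR : R ∈ C) (hR' : R' ∈ A) (h : L.Overlap K R R') : R' ∈ C := by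
  obtain ⟨Q, -, rfl⟩ := mem_clusters.mp hC
  exact mem_cluster.mpr ⟨hR', (mem_cluster.mp hR).2.tail ⟨hR', h⟩⟩

theorem reflTransGen_overlap_symm {R R' : L.Label} (hR : R ∈ A)
    (h : Relation.ReflTransGen (fun P P' => P' ∈ A ∧ L.Overlap K P P') R R') :
    R' ∈ A ∧ Relation.ReflTransGen (fun P P' => P' ∈ A ∧ L.Overlap K P P') R' R := by
  induction h with
  | refl => exact ⟨hR, Relation.ReflTransGen.refl⟩
  | tail _ h ih => exact ⟨h.1, ih.2.head ⟨ih.1, L.overlap_symm h.2⟩⟩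

/-- Any two elements of a cluster are connected by a path of overlapping labels. -/
theorem reflTransGen_of_mem_clusters {C : Finset L.Label} (hC : C ∈ L.clusters K A)
    {R R' : L.Label} (hR : R ∈ C) (hR' : R' ∈ C) :
    Relation.ReflTransGen (fun P P' => P' ∈ A ∧ L.Overlap K P P') R R' := by
  obtain ⟨Q, hQ, rfl⟩ := mem_clusters.mp hC
  exact (reflTransGen_overlap_symm hQ (mem_cluster.mp hR).2).2.trans
    (mem_cluster.mp hR').2

theorem clusters_eq_of_mem {C C' : Finset L.Label} (hC : C ∈ L.clusters K A)
    (hC' : C' ∈ L.clusters K A) {R : L.Label} (hR : R ∈ C) (hR' : R ∈ C') : C = C' := by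
  have key : ∀ {C C' : Finset L.Label}, C ∈ L.clusters K A → C' ∈ L.clusters K A →
      R ∈ C → R ∈ C' → C ⊆ C' := by
    intro C C' hC hC' hR hR' Q hQ
    have h := reflTransGen_of_mem_clusters hC hR hQ
    obtain ⟨P, -, rfl⟩ := mem_clusters.mp hC'
    exact mem_cluster.mpr ⟨subset_of_mem_clusters hC hQ, (mem_cluster.mp hR').2.trans h⟩
  exact (key hC hC' hR hR').antisymm (key hC' hC hR' hR)

end Clusters

/-! ### Commutators with the spin-lowering operators -/

theorem c_mul_dag_c (σ τ : Fin 2) (o o' : L.Orb) : L.c σ o * dag (L.c τ o') =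
    open Classical in (if o = o' ∧ σ = τ then 1 else 0) - dag (L.c τ o') * L.c σ o := by
  classical
  have := ann_mul_dag_ann (o, σ) (o', τ)
  simp only [Prod.mk.injEq] at this
  exact this

theorem c_zero_mul_spinLower (K : Couplings) (C : Finset L.Label) (o : L.Orb) :
    L.c 0 o * L.spinLower K C = L.spinLower K C * L.c 0 o := by
  rw [spinLower, Finset.mul_sum, Finset.sum_mul]
  refine Finset.sum_congr rfl fun o' _ => ?_
  rw [← mul_assoc, c_mul_dag_c, if_neg (by simp), zero_sub, neg_mul, mul_assoc, c_mul_c]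
  simp [mul_assoc]

open Classical in
theorem c_one_mul_spinLower (K : Couplings) (C : Finset L.Label) (o : L.Orb) :
    L.c 1 o * L.spinLower K C = L.spinLower K C * L.c 1 o +
      if ∃ R ∈ C, L.φ K R o ≠ 0 then L.c 0 o else 0 := by
  rw [spinLower, Finset.mul_sum, Finset.sum_mul]
  have : ∀ o', L.c 1 o * (dag (L.c 1 o') * L.c 0 o') =
      dag (L.c 1 o') * L.c 0 o' * L.c 1 o + if o = o' then L.c 0 o' else 0 := by
    intro o'
    rw [← mul_assoc, c_mul_dag_c, sub_mul, mul_assoc (dag _), L.c_mul_c 1 0]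
    by_cases h : o = o' <;> simp [h, mul_assoc, add_comm]
  simp only [this, Finset.sum_add_distrib, Finset.sum_ite_eq, Finset.mem_filter, Finset.mem_univ,
    true_and]

open Classical in
/-- The effect of the spin-lowering operator of a cluster on the annihilation of the `f` electron
at `R`. -/
theorem c_inl_mul_spinLower (K : Couplings) (htfp : 0 < K.tfp) (C : Finset L.Label) (σ : Fin 2)
    (R : L.Label) : L.c σ (Sum.inl R) * L.spinLower K C = L.spinLower K C * L.c σ (Sum.inl R) +
      if R ∈ C ∧ σ = 1 then L.c 0 (Sum.inl R) else 0 := by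
  obtain rfl | rfl : σ = 0 ∨ σ = 1 := by omega
  · rw [c_zero_mul_spinLower]
    simp
  · rw [c_one_mul_spinLower]
    simp [L.φ_inl K htfp]

theorem spinLower_apply_empty (K : Couplings) (C : Finset L.Label) (ψ : Fock L.Mode) :
    L.spinLower K C ψ ∅ = 0 := by
  rw [spinLower, LinearMap.sum_apply, WithLp.ofLp_sum, Finset.sum_apply]
  refine Finset.sum_eq_zero fun o _ => ?_
  rw [Module.End.mul_apply, c]
  exact dag_ann_apply_empty _ _

theorem spinLower_mem_sector (K : Couplings) (C : Finset L.Label) {n : ℕ} {ψ : Fock L.Mode}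
    (h : ψ ∈ sector (M := L.Mode) n) : L.spinLower K C ψ ∈ sector (M := L.Mode) n := by
  rw [spinLower, LinearMap.sum_apply]
  refine Submodule.sum_mem _ fun o _ => ?_
  rw [Module.End.mul_apply]
  cases n with
  | zero =>
    rw [c, c, ann_mem_sector_zero _ h, map_zero]
    exact Submodule.zero_mem _
  | succ n => exact dag_ann_mem_sector _ (ann_mem_sector _ h)

/-- The ground states built on the set of labels `A`: states in the flat band without singlets on
overlapping labels, in which each label of `A` and no other label is occupied. -/
structure IsGroundOn (K : Couplings) (A : Finset L.Label) (ψ : Fock L.Mode) : Prop where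
  dev : ∀ o σ, L.dev K σ o ψ = 0
  labelSinglet : ∀ R R', L.Overlap K R R' → L.labelSinglet R R' ψ = 0
  mem_sector : ψ ∈ sector (M := L.Mode) A.card
  c_eq_zero : ∀ R, R ∉ A → ∀ σ, L.c σ (Sum.inl R) ψ = 0

variable {L}

/-- The lowering operator of a cluster `C` preserves the ground states on `A`. Its commutator with the
annihilator `dev` of a `p` orbital in the support of `C` is, on a flat-band state, the combination of
the `f` annihilators of those labels outside of `C` that have weight on this orbital. They overlap
with `C`, so they are not in `A`. -/
theorem IsGroundOn.spinLower {K : Couplings} (htf : 0 < K.tf) (htfp : 0 < K.tfp)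
    {A C : Finset L.Label} (hC : C ∈ L.clusters K A) {ψ : Fock L.Mode} (h : L.IsGroundOn K A ψ) :
    L.IsGroundOn K A (L.spinLower K C ψ) := by
  classical
  refine ⟨fun o σ => ?_, fun R R' hov => ?_, L.spinLower_mem_sector K C h.mem_sector,
    fun R hR σ => ?_⟩
  · obtain rfl | rfl : σ = 0 ∨ σ = 1 := by omega
    · have : L.dev K 0 o * L.spinLower K C = L.spinLower K C * L.dev K 0 o := by
        simp only [dev_eq, sub_mul, mul_sub, Finset.sum_mul, Finset.mul_sum, smul_mul_assoc,
          mul_smul_comm, c_zero_mul_spinLower]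
      rw [← Module.End.mul_apply, this, Module.End.mul_apply, h.dev, map_zero]
    · have : L.dev K 1 o * L.spinLower K C = L.spinLower K C * L.dev K 1 o +
          ((if ∃ R ∈ C, L.φ K R (Sum.inr o) ≠ 0 then L.c 0 (Sum.inr o) else 0) -
            ∑ R : L.Label, ((K.tf / K.tfp * L.cornerAmp R.1 o.1.1 o.2 : ℝ) : ℂ) •
              if R ∈ C then L.c 0 (Sum.inl R) else 0) := by
        have h1 : ∀ R : L.Label, (∃ Q ∈ C, L.φ K Q (Sum.inl R) ≠ 0) ↔ R ∈ C := fun R => by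
          simp [L.φ_inl K htfp]
        simp only [dev_eq, sub_mul, mul_sub, Finset.sum_mul, Finset.mul_sum, smul_mul_assoc,
          mul_smul_comm, c_one_mul_spinLower, smul_add, Finset.sum_add_distrib, h1]
        abel
      rw [← Module.End.mul_apply, this, LinearMap.add_apply, Module.End.mul_apply, h.dev, map_zero,
        zero_add]
      -- A label of `A` with weight on the orbital `o` belongs to `C` if `C` covers `o`.
      have h2 : ∀ R : L.Label, L.cornerAmp R.1 o.1.1 o.2 ≠ 0 → R ∈ A →
          ((∃ Q ∈ C, L.φ K Q (Sum.inr o) ≠ 0) ↔ R ∈ C) := by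
        intro R h0 hRA
        rw [← L.φ_inr K htf] at h0
        exact ⟨fun ⟨Q, hQ, hQo⟩ => mem_of_overlap hC hQ hRA ⟨_, hQo, h0⟩, fun hR => ⟨R, hR, h0⟩⟩
      rw [LinearMap.sub_apply, LinearMap.sum_apply, sub_eq_zero]
      have h3 : (if ∃ R ∈ C, L.φ K R (Sum.inr o) ≠ 0 then L.c 0 (Sum.inr o) else 0) ψ =
          ∑ R : L.Label, ((K.tf / K.tfp * L.cornerAmp R.1 o.1.1 o.2 : ℝ) : ℂ) •
            (if ∃ R ∈ C, L.φ K R (Sum.inr o) ≠ 0 then L.c 0 (Sum.inl R) ψ else 0) := by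
        split_ifs with hs
        · exact L.c_inr_apply h.dev 0 o
        · simp
      rw [h3]
      refine Finset.sum_congr rfl fun R _ => ?_
      rw [LinearMap.smul_apply]
      by_cases h0 : L.cornerAmp R.1 o.1.1 o.2 = 0
      · simp [h0]
      congr 1
      by_cases hRA : R ∈ A
      · rw [if_congr (h2 R h0 hRA) rfl rfl]
        split_ifs <;> simp
      · have hz := h.c_eq_zero R hRA 0
        split_ifs <;> simp [hz]
  · have : L.labelSinglet R R' * L.spinLower K C = L.spinLower K C * L.labelSinglet R R' +
        ((if R' ∈ C then L.c 0 (Sum.inl R) * L.c 0 (Sum.inl R') else 0) -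
          if R ∈ C then L.c 0 (Sum.inl R) * L.c 0 (Sum.inl R') else 0) := by
      rw [TwoLayer.labelSinglet, sub_mul, mul_assoc, mul_assoc, c_inl_mul_spinLower _ _ htfp,
        c_inl_mul_spinLower _ _ htfp, mul_add, mul_add, ← mul_assoc, ← mul_assoc,
        c_inl_mul_spinLower _ _ htfp, c_inl_mul_spinLower _ _ htfp]
      simp only [add_mul, mul_sub, mul_assoc]
      by_cases h1 : R ∈ C <;> by_cases h2 : R' ∈ C <;> simp [h1, h2] <;> abel
    rw [← Module.End.mul_apply, this, LinearMap.add_apply, Module.End.mul_apply,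
      h.labelSinglet _ _ hov, map_zero, zero_add, LinearMap.sub_apply]
    by_cases hRA : R ∈ A
    · by_cases hRA' : R' ∈ A
      · have : R ∈ C ↔ R' ∈ C := ⟨fun hR => mem_of_overlap hC hR hRA' hov,
          fun hR => mem_of_overlap hC hR hRA (L.overlap_symm hov)⟩
        rw [if_congr this rfl rfl, sub_self]
      · have hz : (L.c 0 (Sum.inl R) * L.c 0 (Sum.inl R')) ψ = 0 := by
          rw [Module.End.mul_apply, h.c_eq_zero R' hRA', map_zero]
        split_ifs <;> simp [hz]
    · have hz : (L.c 0 (Sum.inl R) * L.c 0 (Sum.inl R')) ψ = 0 := by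
        rw [c_mul_c, LinearMap.neg_apply, Module.End.mul_apply, h.c_eq_zero R hRA, map_zero,
          neg_zero]
      split_ifs <;> simp [hz]
  · have hRC : R ∉ C := fun h' => hR (subset_of_mem_clusters hC h')
    rw [← Module.End.mul_apply, c_inl_mul_spinLower _ _ htfp, if_neg (fun h => hRC h.1), add_zero,
      Module.End.mul_apply, h.c_eq_zero R hR, map_zero]

/-! ### The fully polarized states -/

open Classical in
theorem c_mul_aDag (K : Couplings) (σ : Fin 2) (o : L.Orb) (R : L.Label) :
    L.c σ o * L.aDag K R 0 =
      (if σ = 0 then (L.φ K R o : ℂ) else 0) • 1 - L.aDag K R 0 * L.c σ o := by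
  rw [aDag, Finset.mul_sum, Finset.sum_mul]
  simp only [mul_smul_comm, smul_mul_assoc, c_mul_dag_c, smul_sub, Finset.sum_sub_distrib]
  congr 1
  rw [Finset.sum_eq_single o]
  · by_cases h : σ = 0 <;> simp [h]
  · intro o' _ ho'
    simp [Ne.symm ho']
  · simp

theorem dev_mul_aDag (K : Couplings) (htfp : 0 < K.tfp) (σ : Fin 2)
    (o : {r : L.Site // r ∈ L.Λp} × Fin 2) (R : L.Label) :
    L.dev K σ o * L.aDag K R 0 = -(L.aDag K R 0 * L.dev K σ o) := by
  classical
  simp only [dev_eq, sub_mul, mul_sub, Finset.sum_mul, Finset.mul_sum, smul_mul_assoc,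
    mul_smul_comm, c_mul_aDag, smul_sub, Finset.sum_sub_distrib]
  have : (if σ = 0 then (L.φ K R (Sum.inr o) : ℂ) else 0) • (1 : Op L.Mode) =
      ∑ Q : L.Label, ((K.tf / K.tfp * L.cornerAmp Q.1 o.1.1 o.2 : ℝ) : ℂ) •
        (if σ = 0 then (L.φ K R (Sum.inl Q) : ℂ) else 0) • (1 : Op L.Mode) := by
    rw [Finset.sum_eq_single R]
    · have hφ : L.φ K R (Sum.inr o) =
          K.tf / K.tfp * L.cornerAmp R.1 o.1.1 o.2 * L.φ K R (Sum.inl R) := by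
        obtain ⟨r, d⟩ := o
        show K.tf / √(6 * K.tf ^ 2 + K.tfp ^ 2) * L.cornerAmp R.1 r.1 d =
          K.tf / K.tfp * L.cornerAmp R.1 r.1 d *
            (if R = R then K.tfp / √(6 * K.tf ^ 2 + K.tfp ^ 2) else 0)
        rw [if_pos rfl]
        field_simp
      rw [hφ, smul_smul]
      split_ifs <;> simp
    · intro Q _ hQ
      have : L.φ K R (Sum.inl Q) = 0 := by
        by_contra h0
        exact hQ ((L.φ_inl K htfp R Q).mp h0)
      simp [this]
    · simp
  rw [this]
  abel

theorem aDag_mem_sector (K : Couplings) (R : L.Label) (σ : Fin 2) {n : ℕ} {ψ : Fock L.Mode}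
    (h : ψ ∈ sector (M := L.Mode) n) : L.aDag K R σ ψ ∈ sector (M := L.Mode) (n + 1) := by
  rw [aDag, LinearMap.sum_apply]
  exact Submodule.sum_mem _ fun o _ => Submodule.smul_mem _ _ (dag_ann_mem_sector _ h)

theorem dev_vacuum (K : Couplings) (σ : Fin 2) (o : {r : L.Site // r ∈ L.Λp} × Fin 2) :
    L.dev K σ o vacuum = 0 := by
  simp [dev, annOf, ann_vacuum]

variable (L) in
/-- The state in which the localized orbitals in the list are occupied by spin-up electrons. -/
noncomputable def polarized (K : Couplings) (l : List L.Label) : Fock L.Mode :=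
  (l.map (fun R => L.aDag K R 0)).prod vacuum

theorem polarized_cons (K : Couplings) (R : L.Label) (l : List L.Label) :
    L.polarized K (R :: l) = L.aDag K R 0 (L.polarized K l) := by
  simp [polarized]

theorem dev_polarized (K : Couplings) (htfp : 0 < K.tfp) (l : List L.Label) (σ : Fin 2)
    (o : {r : L.Site // r ∈ L.Λp} × Fin 2) : L.dev K σ o (L.polarized K l) = 0 := by
  induction l with
  | nil => exact dev_vacuum K σ o
  | cons R l ih =>
    rw [polarized_cons, ← Module.End.mul_apply, dev_mul_aDag _ htfp, LinearMap.neg_apply,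
      Module.End.mul_apply, ih, map_zero, neg_zero]

theorem c_polarized (K : Couplings) (htfp : 0 < K.tfp) (l : List L.Label) (σ : Fin 2)
    (R : L.Label) (h : σ = 0 → R ∉ l) : L.c σ (Sum.inl R) (L.polarized K l) = 0 := by
  induction l with
  | nil => exact ann_vacuum _
  | cons Q l ih =>
    have h0 : (if σ = 0 then (L.φ K Q (Sum.inl R) : ℂ) else 0) = 0 := by
      split_ifs with hσ
      · have hQ : R ≠ Q := fun e => h hσ (by simp [e])
        have : L.φ K Q (Sum.inl R) = 0 := by
          by_contra h0
          exact hQ ((L.φ_inl K htfp Q R).mp h0)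
        simp [this]
      · rfl
    rw [polarized_cons, ← Module.End.mul_apply, c_mul_aDag, h0, zero_smul, zero_sub,
      LinearMap.neg_apply, Module.End.mul_apply,
      ih fun hσ hl => h hσ (List.mem_cons_of_mem _ hl), map_zero, neg_zero]

theorem polarized_mem_sector (K : Couplings) (l : List L.Label) :
    L.polarized K l ∈ sector (M := L.Mode) l.length := by
  induction l with
  | nil => exact vacuum_mem_sector
  | cons R l ih =>
    rw [polarized_cons]
    exact aDag_mem_sector K R 0 ih

theorem isGroundOn_polarized (K : Couplings) (htfp : 0 < K.tfp) (A : Finset L.Label) :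
    L.IsGroundOn K A (L.polarized K A.toList) := by
  refine ⟨fun o σ => dev_polarized K htfp _ σ o, fun R R' _ => ?_, ?_, fun R hR σ =>
    c_polarized K htfp _ σ R fun _ => by simpa using hR⟩
  · have h1 : ∀ R, L.c 1 (Sum.inl R) (L.polarized K A.toList) = 0 := fun R =>
      c_polarized K htfp _ 1 R (by simp)
    rw [labelSinglet, L.c_mul_c 1 0, LinearMap.sub_apply, LinearMap.neg_apply,
      Module.End.mul_apply, Module.End.mul_apply, h1, h1]
    simp
  · have := polarized_mem_sector K A.toList
    rwa [Finset.length_toList] at this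

end TwoLayer
end FlatBand

/-! ### Amplitudes of the cluster states -/

namespace FlatBand

namespace TwoLayer

variable (L : TwoLayer)

/-- The product over the labels `R` in the list of the annihilators of an electron of spin `s R` in
the `f` orbital at `R`. -/
noncomputable def annWord (s : L.Label → Fin 2) (l : List L.Label) : Op L.Mode :=
  (l.map fun R => L.c (s R) (Sum.inl R)).prod

/-- The amplitude of a state for `f` electrons with spins `s` on the labels in the list. -/
noncomputable def amp (ψ : Fock L.Mode) (s : L.Label → Fin 2) (l : List L.Label) : ℂ :=
  L.annWord s l ψ ∅

variable {L}

theorem annWord_cons (s : L.Label → Fin 2) (R : L.Label) (l : List L.Label) :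
    L.annWord s (R :: l) = L.c (s R) (Sum.inl R) * L.annWord s l := by
  simp [annWord]

theorem annWord_append (s : L.Label → Fin 2) (l l' : List L.Label) :
    L.annWord s (l ++ l') = L.annWord s l * L.annWord s l' := by
  simp [annWord]

theorem annWord_congr {s s' : L.Label → Fin 2} {l : List L.Label} (h : ∀ R ∈ l, s R = s' R) :
    L.annWord s l = L.annWord s' l := by
  rw [annWord, annWord, List.map_congr_left fun R hR => by rw [h R hR]]

/-- Reordering the labels changes the amplitudes by a sign that does not depend on the spins. -/
theorem annWord_perm {l l' : List L.Label} (h : l.Perm l') :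
    ∃ ε : ℂ, ε ≠ 0 ∧ ∀ s, L.annWord s l = ε • L.annWord s l' := by
  induction h with
  | nil => exact ⟨1, one_ne_zero, fun s => by simp⟩
  | cons R _ ih =>
    obtain ⟨ε, h0, h⟩ := ih
    exact ⟨ε, h0, fun s => by rw [annWord_cons, annWord_cons, h, mul_smul_comm]⟩
  | swap R Q l =>
    refine ⟨-1, by simp, fun s => ?_⟩
    simp only [annWord_cons, ← mul_assoc]
    rw [c_mul_c]
    simp
  | trans _ _ ih ih' =>
    obtain ⟨ε, h0, h⟩ := ih
    obtain ⟨ε', h0', h'⟩ := ih'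
    exact ⟨ε * ε', mul_ne_zero h0 h0', fun s => by rw [h, h', smul_smul]⟩

theorem c_mul_annWord (σ : Fin 2) (o : L.Orb) (s : L.Label → Fin 2) (l : List L.Label) :
    ∃ ε : ℂ, L.c σ o * L.annWord s l = ε • (L.annWord s l * L.c σ o) := by
  induction l with
  | nil => exact ⟨1, by simp [annWord]⟩
  | cons R l ih =>
    obtain ⟨ε, h⟩ := ih
    refine ⟨-ε, ?_⟩
    rw [annWord_cons, ← mul_assoc, c_mul_c, neg_mul, mul_assoc, h]
    simp [mul_assoc]

theorem annWord_apply_eq_zero {s : L.Label → Fin 2} {l : List L.Label} {R : L.Label} (hR : R ∈ l)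
    {ψ : Fock L.Mode} (h : L.c (s R) (Sum.inl R) ψ = 0) : L.annWord s l ψ = 0 := by
  induction l with
  | nil => simp at hR
  | cons Q l ih =>
    rw [annWord_cons]
    rcases List.mem_cons.mp hR with rfl | hR
    · obtain ⟨ε, hε⟩ := c_mul_annWord (s R) (Sum.inl R) s l
      rw [hε, LinearMap.smul_apply, Module.End.mul_apply, h, map_zero, smul_zero]
    · rw [Module.End.mul_apply, ih hR, map_zero]

open Classical in
/-- Commuting annihilators through the lowering operator of `C` reverses one of the down spins
on `C`. -/
theorem annWord_mul_spinLower (K : Couplings) (htfp : 0 < K.tfp) (C : Finset L.Label)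
    (s : L.Label → Fin 2) {l : List L.Label} (hl : l.Nodup) :
    L.annWord s l * L.spinLower K C = L.spinLower K C * L.annWord s l +
      ∑ R ∈ l.toFinset, if R ∈ C ∧ s R = 1 then L.annWord (Function.update s R 0) l else 0 := by
  induction l with
  | nil => simp [annWord]
  | cons Q l ih =>
    obtain ⟨hQ, hl⟩ := List.nodup_cons.mp hl
    rw [annWord_cons, mul_assoc, ih hl, mul_add, ← mul_assoc, c_inl_mul_spinLower _ _ htfp, add_mul,
      List.toFinset_cons, Finset.sum_insert (by simpa using hQ), mul_assoc, add_assoc]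
    congr 2
    · rw [ite_mul, zero_mul]
      congr 1
      rw [annWord_cons, Function.update_self, annWord_congr (s := s) (s' := Function.update s Q 0)]
      intro R hR
      rw [Function.update_of_ne]
      rintro rfl
      exact hQ hR
    · rw [Finset.mul_sum]
      refine Finset.sum_congr rfl fun R hR => ?_
      rw [mul_ite, mul_zero]
      congr 1
      rw [annWord_cons, Function.update_of_ne]
      rintro rfl
      exact hQ (List.mem_toFinset.mp hR)

/-- The number of spin-down electrons in a spin configuration on `C`. -/
def downs (s : L.Label → Fin 2) (C : Finset L.Label) : ℕ := (C.filter fun R => s R = 1).card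

variable (L) in
/-- The amplitudes of `ψ` on the labels `A` are equal for all spin configurations with `m C`
electrons of spin down in each cluster `C`, and vanish for all others. -/
def HasDowns (K : Couplings) (A : Finset L.Label) (m : Finset L.Label → ℕ) (ψ : Fock L.Mode) :
    Prop :=
  ∃ κ : ℂ, κ ≠ 0 ∧ ∀ s, L.amp ψ s A.toList =
    open Classical in if ∀ C ∈ L.clusters K A, downs s C = m C then κ else 0

section Lowering

variable {K : Couplings} {A : Finset L.Label}

open Classical in
theorem downs_update {C C' : Finset L.Label} (hC : C ∈ L.clusters K A) (hC' : C' ∈ L.clusters K A)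
    {s : L.Label → Fin 2} {R : L.Label} (hR : R ∈ C) (hs : s R = 1) :
    downs s C' = downs (Function.update s R 0) C' + if C' = C then 1 else 0 := by
  by_cases h : C' = C
  · subst h
    have : C'.filter (fun Q => Function.update s R 0 Q = 1) =
        (C'.filter fun Q => s Q = 1).erase R := by
      ext Q
      by_cases hQ : Q = R
      · subst hQ; simp
      · simp [hQ]
    have hm : R ∈ C'.filter fun Q => s Q = 1 := Finset.mem_filter.mpr ⟨hR, hs⟩
    rw [downs, downs, this, if_pos rfl, Finset.card_erase_add_one hm]
  · rw [if_neg h, add_zero, downs, downs]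
    congr 1
    refine Finset.filter_congr fun Q hQ => ?_
    rw [Function.update_of_ne]
    rintro rfl
    exact h (clusters_eq_of_mem hC' hC hQ hR)

open Classical in
/-- The amplitude after lowering is the sum over the `m C + 1` down spins of the configuration that
may have been produced by the lowering. -/
theorem HasDowns.spinLower (htfp : 0 < K.tfp) {C : Finset L.Label} (hC : C ∈ L.clusters K A)
    {m : Finset L.Label → ℕ} {ψ : Fock L.Mode} (h : L.HasDowns K A m ψ) :
    L.HasDowns K A (fun C' => m C' + if C' = C then 1 else 0) (L.spinLower K C ψ) := by
  obtain ⟨κ, h0, h⟩ := h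
  refine ⟨(m C + 1 : ℕ) * κ, mul_ne_zero (Nat.cast_ne_zero.mpr (Nat.succ_ne_zero _)) h0,
    fun s => ?_⟩
  have h1 : L.amp (L.spinLower K C ψ) s A.toList = ∑ R ∈ A, if R ∈ C ∧ s R = 1 then
      L.amp ψ (Function.update s R 0) A.toList else 0 := by
    rw [amp, ← Module.End.mul_apply, annWord_mul_spinLower _ htfp _ _ A.nodup_toList,
      LinearMap.add_apply, PiLp.add_apply, Module.End.mul_apply, spinLower_apply_empty, zero_add,
      LinearMap.sum_apply, WithLp.ofLp_sum, Finset.sum_apply, Finset.toList_toFinset]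
    refine Finset.sum_congr rfl fun R _ => ?_
    split_ifs <;> rfl
  have h2 : ∀ R, (if R ∈ C ∧ s R = 1 then L.amp ψ (Function.update s R 0) A.toList else 0) =
      if R ∈ C ∧ s R = 1 then
        (if ∀ C' ∈ L.clusters K A, downs s C' = m C' + if C' = C then 1 else 0 then κ else 0)
        else 0 := by
    intro R
    split_ifs with hR hm
    · rw [h, if_pos]
      intro C' hC'
      have := hm C' hC'
      rw [downs_update hC hC' hR.1 hR.2] at this
      exact Nat.add_right_cancel this
    · rw [h, if_neg]
      intro hm'
      refine hm fun C' hC' => ?_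
      rw [downs_update hC hC' hR.1 hR.2, hm' C' hC']
    · rfl
  rw [h1, Finset.sum_congr rfl fun R _ => h2 R, ← Finset.sum_filter, Finset.sum_const]
  have h3 : (A.filter fun R => R ∈ C ∧ s R = 1) = C.filter fun R => s R = 1 := by
    ext R
    simp only [Finset.mem_filter]
    exact ⟨fun h => h.2, fun h => ⟨subset_of_mem_clusters hC h.1, h⟩⟩
  rw [h3]
  change downs s C • _ = _
  split_ifs with hm
  · rw [hm C hC, if_pos rfl, nsmul_eq_mul]
  · simp

open Classical in
theorem HasDowns.spinLower_pow (htfp : 0 < K.tfp) {C : Finset L.Label} (hC : C ∈ L.clusters K A)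
    {m : Finset L.Label → ℕ} {ψ : Fock L.Mode} (h : L.HasDowns K A m ψ) (k : ℕ) :
    L.HasDowns K A (fun C' => m C' + if C' = C then k else 0) ((L.spinLower K C ^ k) ψ) := by
  induction k with
  | zero => simpa using h
  | succ k ih =>
    rw [pow_succ', Module.End.mul_apply]
    convert ih.spinLower htfp hC using 2 with C'
    split_ifs <;> ring

/-- The constant is a sign times a power of the `f` amplitude of the localized states. -/
theorem annWord_polarized (htfp : 0 < K.tfp) {l : List L.Label} (hl : l.Nodup) :
    ∃ κ : ℂ, κ ≠ 0 ∧ L.annWord 0 l (L.polarized K l) = κ • vacuum := by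
  classical
  have hcomm : ∀ (R : L.Label) (l : List L.Label), R ∉ l →
      ∃ ε : ℂ, ε ≠ 0 ∧ L.annWord 0 l * L.aDag K R 0 = ε • (L.aDag K R 0 * L.annWord 0 l) := by
    intro R l
    induction l with
    | nil => exact fun _ => ⟨1, one_ne_zero, by simp [annWord]⟩
    | cons Q l ih =>
      intro hR
      rw [List.mem_cons, not_or] at hR
      obtain ⟨ε, h0, h⟩ := ih hR.2
      have hφ : L.φ K R (Sum.inl Q) = 0 := by
        by_contra h0
        exact hR.1 ((L.φ_inl K htfp R Q).mp h0).symm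
      refine ⟨-ε, neg_ne_zero.mpr h0, ?_⟩
      rw [annWord_cons, mul_assoc, h, mul_smul_comm, ← mul_assoc, c_mul_aDag, hφ]
      simp [mul_assoc]
  induction l with
  | nil => exact ⟨1, one_ne_zero, by simp [annWord, polarized]⟩
  | cons R l ih =>
    obtain ⟨hR, hl⟩ := List.nodup_cons.mp hl
    obtain ⟨κ, h0, h⟩ := ih hl
    obtain ⟨ε, h0', h'⟩ := hcomm R l hR
    refine ⟨ε * κ * L.φ K R (Sum.inl R), mul_ne_zero (mul_ne_zero h0' h0) ?_, ?_⟩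
    · exact Complex.ofReal_ne_zero.mpr ((L.φ_inl K htfp R R).mpr rfl)
    · have h1 : L.annWord 0 l (L.aDag K R 0 (L.polarized K l)) =
          (ε * κ) • L.aDag K R 0 vacuum := by
        rw [← Module.End.mul_apply, h', LinearMap.smul_apply, Module.End.mul_apply, h, map_smul,
          smul_smul]
      rw [annWord_cons, polarized_cons, Module.End.mul_apply, h1, map_smul,
        ← Module.End.mul_apply, c_mul_aDag, LinearMap.sub_apply, Module.End.mul_apply, c,
        ann_vacuum, map_zero, sub_zero, if_pos (Pi.zero_apply R), LinearMap.smul_apply,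
        Module.End.one_apply, smul_smul]

theorem hasDowns_polarized (htfp : 0 < K.tfp) :
    L.HasDowns K A (fun _ => 0) (L.polarized K A.toList) := by
  classical
  obtain ⟨κ, h0, h⟩ := annWord_polarized (K := K) htfp A.nodup_toList
  refine ⟨κ, h0, fun s => ?_⟩
  have hiff : (∀ C ∈ L.clusters K A, downs s C = 0) ↔ ∀ R ∈ A, s R = 0 := by
    constructor
    · intro hs R hR
      have := hs _ (cluster_mem_clusters hR)
      rw [downs, Finset.card_eq_zero, Finset.filter_eq_empty_iff] at this
      have := this (mem_cluster_self hR)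
      omega
    · intro hs C hC
      rw [downs, Finset.card_eq_zero, Finset.filter_eq_empty_iff]
      intro R hR
      rw [hs R (subset_of_mem_clusters hC hR)]
      decide
  split_ifs with hs
  · rw [amp, annWord_congr (s' := 0) (fun R hR => hiff.mp hs R (by simpa using hR)), h]
    simp [vacuum_apply_empty]
  · rw [hiff] at hs
    push Not at hs
    obtain ⟨R, hR, hsR⟩ := hs
    rw [amp, annWord_apply_eq_zero (R := R) (by simpa using hR)]
    · rfl
    · exact c_polarized K htfp _ _ _ fun h => absurd h hsR

/-- Products of powers of spin-lowering operators of different clusters keep the states on `A`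
unfrustrated, and set the number of spin-down electrons in each cluster. -/
theorem isGroundOn_hasDowns_prod (htf : 0 < K.tf) (htfp : 0 < K.tfp) (n : Finset L.Label → ℕ)
    {l : List (Finset L.Label)} (hl : l.Nodup) (hlA : ∀ C ∈ l, C ∈ L.clusters K A) :
    L.IsGroundOn K A ((l.map fun C => L.spinLower K C ^ n C).prod (L.polarized K A.toList)) ∧
      L.HasDowns K A (open Classical in fun C => if C ∈ l then n C else 0)
        ((l.map fun C => L.spinLower K C ^ n C).prod (L.polarized K A.toList)) := by
  classical
  induction l with
  | nil => exact ⟨isGroundOn_polarized K htfp A, by simpa using hasDowns_polarized htfp⟩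
  | cons C l ih =>
    obtain ⟨hCl, hl⟩ := List.nodup_cons.mp hl
    obtain ⟨h1, h2⟩ := ih hl fun C hC => hlA C (List.mem_cons_of_mem _ hC)
    have hC := hlA C List.mem_cons_self
    rw [List.map_cons, List.prod_cons, Module.End.mul_apply]
    constructor
    · induction n C with
      | zero => simpa using h1
      | succ k ihk =>
        rw [pow_succ', Module.End.mul_apply]
        exact ihk.spinLower htf htfp hC
    · convert h2.spinLower_pow htfp hC (n C) using 2 with C'
      by_cases h : C' = C
      · subst h
        simp [hCl]
      · simp [h]

theorem clusterState_eq (n : Finset L.Label → ℕ) : L.clusterState K A n =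
    ((L.clusters K A).toList.map fun C => L.spinLower K C ^ n C).prod
      (L.polarized K A.toList) := by
  rw [clusterState, Module.End.mul_apply, polarized]

theorem isGroundOn_clusterState (htf : 0 < K.tf) (htfp : 0 < K.tfp) (n : Finset L.Label → ℕ) :
    L.IsGroundOn K A (L.clusterState K A n) := by
  rw [clusterState_eq]
  exact (isGroundOn_hasDowns_prod htf htfp n (Finset.nodup_toList _)
    fun C hC => Finset.mem_toList.mp hC).1

theorem hasDowns_clusterState (htf : 0 < K.tf) (htfp : 0 < K.tfp) (n : Finset L.Label → ℕ) :
    L.HasDowns K A n (L.clusterState K A n) := by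
  classical
  rw [clusterState_eq]
  obtain ⟨κ, h0, h⟩ :=
    (isGroundOn_hasDowns_prod (A := A) htf htfp n (Finset.nodup_toList _)
      fun C hC => Finset.mem_toList.mp hC).2
  refine ⟨κ, h0, fun s => (h s).trans (if_congr ?_ rfl rfl)⟩
  refine forall₂_congr fun C hC => ?_
  beta_reduce
  rw [if_pos (Finset.mem_toList.mpr hC)]

end Lowering

end TwoLayer
end FlatBand

/-! ### Spanning by the cluster states -/

namespace FlatBand

namespace TwoLayer

variable {L : TwoLayer} {K : Couplings}

section Symmetry

variable {ψ : Fock L.Mode}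

/-- The absence of singlets on an overlapping pair of labels makes the amplitudes symmetric under
the exchange of the spins on this pair. -/
theorem amp_swap_of_overlap (hψ : ∀ R R', L.Overlap K R R' → L.labelSinglet R R' ψ = 0)
    {A : Finset L.Label} {R R' : L.Label} (hR : R ∈ A) (hR' : R' ∈ A) (h : L.Overlap K R R')
    (s : L.Label → Fin 2) [DecidableEq L.Label] :
    L.amp ψ (s ∘ Equiv.swap R R') A.toList = L.amp ψ s A.toList := by
  by_cases hne : R = R'
  · subst hne
    simp
  set l := ((A.erase R).erase R').toList with hl
  have hperm : A.toList.Perm (l ++ [R, R']) := by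
    refine (List.perm_ext_iff_of_nodup A.nodup_toList ?_).mpr fun Q => ?_
    · refine List.Nodup.append (Finset.nodup_toList _) (by simp [hne]) ?_
      intro Q hQ hQ'
      simp only [hl, Finset.mem_toList, Finset.mem_erase] at hQ
      simp only [List.mem_cons, List.not_mem_nil, or_false] at hQ'
      tauto
    · simp only [hl, List.mem_append, Finset.mem_toList, Finset.mem_erase, List.mem_cons,
        List.not_mem_nil, or_false]
      constructor
      · tauto
      · rintro (h | rfl | rfl)
        exacts [h.2.2, hR, hR']
  obtain ⟨ε, -, hε⟩ := annWord_perm hperm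
  rw [amp, amp, hε, hε, annWord_append, annWord_append,
    annWord_congr (s := s ∘ Equiv.swap R R') (s' := s) (l := l)]
  · have key : L.annWord (s ∘ Equiv.swap R R') [R, R'] ψ = L.annWord s [R, R'] ψ := by
      have h0 : L.c 0 (Sum.inl R) (L.c 1 (Sum.inl R') ψ) =
          L.c 1 (Sum.inl R) (L.c 0 (Sum.inl R') ψ) := by
        have := hψ R R' h
        rwa [labelSinglet, LinearMap.sub_apply, sub_eq_zero] at this
      have h01 : ∀ x : Fin 2, x = 0 ∨ x = 1 := by decide
      simp only [annWord, List.map_cons, List.map_nil, List.prod_cons, List.prod_nil, mul_one,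
        Module.End.mul_apply, Function.comp, Equiv.swap_apply_left, Equiv.swap_apply_right]
      rcases h01 (s R) with h1 | h1 <;> rcases h01 (s R') with h2 | h2 <;> rw [h1, h2]
      · exact h0.symm
      · exact h0
    simp only [LinearMap.smul_apply, Module.End.mul_apply, key]
  · intro Q hQ
    simp only [hl, Finset.mem_toList, Finset.mem_erase] at hQ
    rw [Function.comp, Equiv.swap_apply_of_ne_of_ne hQ.2.1 hQ.1]

/-- The amplitudes are symmetric under the exchange of any two spins of a cluster. -/
theorem amp_swap_of_reachable (hψ : ∀ R R', L.Overlap K R R' → L.labelSinglet R R' ψ = 0)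
    {A : Finset L.Label} {R R' : L.Label} (hR : R ∈ A)
    (h : Relation.ReflTransGen (fun P P' => P' ∈ A ∧ L.Overlap K P P') R R')
    [DecidableEq L.Label] (s : L.Label → Fin 2) :
    L.amp ψ (s ∘ Equiv.swap R R') A.toList = L.amp ψ s A.toList := by
  induction h generalizing s with
  | refl => simp
  | @tail Q P hRQ hQP ih =>
    have hQA : Q ∈ A := (reflTransGen_overlap_symm hR hRQ).1
    by_cases h1 : R = P
    · subst h1; simp
    by_cases h2 : Q = P
    · subst h2; exact ih s
    by_cases h3 : R = Q
    · subst h3; exact amp_swap_of_overlap hψ hQA hQP.1 hQP.2 s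
    have : Equiv.swap R P = Equiv.swap R Q * Equiv.swap Q P * Equiv.swap R Q := by
      rw [Equiv.swap_comm R Q, Equiv.swap_comm Q P]
      exact (Equiv.swap_mul_swap_mul_swap (Ne.symm h2) (Ne.symm h1)).symm
    rw [this]
    rw [Equiv.Perm.coe_mul, Equiv.Perm.coe_mul, ← Function.comp_assoc, ← Function.comp_assoc, ih,
      amp_swap_of_overlap hψ hQA hQP.1 hQP.2, ih]

/-- The amplitudes depend only on the number of spin-down electrons in each cluster. -/
theorem amp_eq_of_downs_eq (hψ : ∀ R R', L.Overlap K R R' → L.labelSinglet R R' ψ = 0)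
    {A : Finset L.Label} {s s' : L.Label → Fin 2}
    (h : ∀ C ∈ L.clusters K A, downs s C = downs s' C) :
    L.amp ψ s A.toList = L.amp ψ s' A.toList := by
  classical
  -- Exchanging two spins of a cluster reduces the number of labels on which `s` and `s'` differ.
  have main : ∀ (k : ℕ) (s : L.Label → Fin 2), (A.filter fun R => s R ≠ s' R).card = k →
      (∀ C ∈ L.clusters K A, downs s C = downs s' C) →
      L.amp ψ s A.toList = L.amp ψ s' A.toList := by
    intro k
    induction k using Nat.strong_induction_on with
    | _ k ih =>
      intro s hk h
      by_cases hs : ∀ R ∈ A, s R = s' R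
      · rw [amp, amp, annWord_congr fun R hR => hs R (Finset.mem_toList.mp hR)]
      push Not at hs
      obtain ⟨R, hR, hne⟩ := hs
      set C := L.cluster K A R with hCdef
      have hC : C ∈ L.clusters K A := cluster_mem_clusters hR
      have hRC : R ∈ C := mem_cluster_self hR
      set D := C.filter fun Q => s Q = 1
      set D' := C.filter fun Q => s' Q = 1
      have hcard : (D \ D').card = (D' \ D).card := Finset.card_sdiff_comm (h C hC)
      have hmem : R ∈ D \ D' ∨ R ∈ D' \ D := by
        simp only [D, D', Finset.mem_sdiff, Finset.mem_filter, hRC, true_and]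
        omega
      have hpos : 0 < (D \ D').card ∧ 0 < (D' \ D).card := by
        rcases hmem with h | h
        · have := Finset.card_pos.mpr ⟨R, h⟩
          omega
        · have := Finset.card_pos.mpr ⟨R, h⟩
          omega
      obtain ⟨P, hP⟩ := Finset.card_pos.mp hpos.1
      obtain ⟨Q, hQ⟩ := Finset.card_pos.mp hpos.2
      simp only [D, D', Finset.mem_sdiff, Finset.mem_filter, not_and] at hP hQ
      obtain ⟨⟨hPC, hP1⟩, hP2⟩ := hP
      obtain ⟨⟨hQC, hQ1⟩, hQ2⟩ := hQ
      have hP2 := hP2 hPC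
      have hQ2 := hQ2 hQC
      have hPA := subset_of_mem_clusters hC hPC
      have hQA := subset_of_mem_clusters hC hQC
      rw [← amp_swap_of_reachable hψ hPA (reflTransGen_of_mem_clusters hC hPC hQC) s]
      refine ih _ ?_ (s ∘ Equiv.swap P Q) rfl fun C' hC' => ?_
      · rw [← hk]
        refine Finset.card_lt_card ⟨fun T hT => ?_, fun hsub => ?_⟩
        · simp only [Finset.mem_filter, Function.comp] at hT ⊢
          refine ⟨hT.1, fun he => hT.2 ?_⟩
          by_cases hTP : T = P
          · subst hTP; rw [Equiv.swap_apply_left]; omega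
          by_cases hTQ : T = Q
          · subst hTQ; rw [Equiv.swap_apply_right]; omega
          rw [Equiv.swap_apply_of_ne_of_ne hTP hTQ, he]
        · have : P ∈ A.filter fun R => s R ≠ s' R :=
            Finset.mem_filter.mpr ⟨hPA, by omega⟩
          have := (Finset.mem_filter.mp (hsub this)).2
          rw [Function.comp, Equiv.swap_apply_left] at this
          omega
      · rw [← h C' hC', downs, downs, ← Finset.card_map (Equiv.swap P Q).toEmbedding]
        congr 1
        have hPQ : P ∈ C' ↔ Q ∈ C' := by
          constructor
          · intro hP'; rw [clusters_eq_of_mem hC' hC hP' hPC]; exact hQC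
          · intro hQ'; rw [clusters_eq_of_mem hC' hC hQ' hQC]; exact hPC
        have hsw : ∀ T, Equiv.swap P Q T ∈ C' ↔ T ∈ C' := by
          intro T
          by_cases hTP : T = P
          · subst hTP; rw [Equiv.swap_apply_left]; exact hPQ.symm
          by_cases hTQ : T = Q
          · subst hTQ; rw [Equiv.swap_apply_right]; exact hPQ
          rw [Equiv.swap_apply_of_ne_of_ne hTP hTQ]
        ext T
        rw [Finset.mem_map_equiv, Equiv.symm_swap]
        simp [hsw]
  exact main _ s rfl h

end Symmetry

section Uniqueness

/-- The product of the annihilators of `f` electrons on the given labels and with the given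
spins. -/
noncomputable def fWord (w : List (L.Label × Fin 2)) : Op L.Mode :=
  (w.map fun x => L.c x.2 (Sum.inl x.1)).prod

theorem c_mul_fWord_eq_zero {ψ : Fock L.Mode} (hψ : ∀ R, L.labelSinglet R R ψ = 0)
    {w : List (L.Label × Fin 2)} {R : L.Label} {σ τ : Fin 2} (h : (R, τ) ∈ w) :
    L.c σ (Sum.inl R) (fWord w ψ) = 0 := by
  have h2 : L.c σ (Sum.inl R) (L.c τ (Sum.inl R) ψ) = 0 := by
    have hp := hψ R
    rw [labelSinglet_self, LinearMap.smul_apply, smul_eq_zero] at hp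
    replace hp := hp.resolve_left (by norm_num)
    have h01 : ∀ x : Fin 2, x = 0 ∨ x = 1 := by decide
    have hself : ∀ ρ, L.c ρ (Sum.inl R) * L.c ρ (Sum.inl R) = 0 := fun ρ => by
      have := L.c_mul_c ρ ρ (Sum.inl R) (Sum.inl R)
      have h2 : (2 : ℂ) • (L.c ρ (Sum.inl R) * L.c ρ (Sum.inl R)) = 0 := by
        rw [two_smul]
        exact add_eq_zero_iff_eq_neg.mpr this
      exact (smul_eq_zero.mp h2).resolve_left two_ne_zero
    rcases h01 σ with rfl | rfl <;> rcases h01 τ with rfl | rfl <;> rw [← Module.End.mul_apply]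
    · rw [hself, LinearMap.zero_apply]
    · rw [c_mul_c, LinearMap.neg_apply]
      exact (congrArg _ hp).trans neg_zero
    · exact hp
    · rw [hself, LinearMap.zero_apply]
  have hcomm : ∀ (ρ : Fin 2) (o : L.Orb) (w : List (L.Label × Fin 2)),
      ∃ ε : ℂ, L.c ρ o * fWord w = ε • (fWord w * L.c ρ o) := by
    intro ρ o w
    induction w with
    | nil => exact ⟨1, by simp [fWord]⟩
    | cons x w ih =>
      obtain ⟨ε, hε⟩ := ih
      refine ⟨-ε, ?_⟩
      have : fWord (x :: w) = L.c x.2 (Sum.inl x.1) * fWord w := by simp [fWord]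
      rw [this, ← mul_assoc, c_mul_c, neg_mul, mul_assoc, hε]
      simp [mul_assoc]
  induction w with
  | nil => simp at h
  | cons x w ih =>
    have hx : fWord (x :: w) = L.c x.2 (Sum.inl x.1) * fWord w := by simp [fWord]
    rw [hx]
    rcases List.mem_cons.mp h with rfl | h
    · obtain ⟨ε, hε⟩ := hcomm τ (Sum.inl R) w
      obtain ⟨ε', hε'⟩ := hcomm σ (Sum.inl R) w
      rw [hε, LinearMap.smul_apply, map_smul, Module.End.mul_apply, ← Module.End.mul_apply, hε',
        LinearMap.smul_apply, Module.End.mul_apply, h2, map_zero, smul_zero, smul_zero]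
    · rw [← Module.End.mul_apply, ← mul_assoc, c_mul_c, neg_mul, LinearMap.neg_apply, mul_assoc,
        Module.End.mul_apply, Module.End.mul_apply, ih h, map_zero, neg_zero]

theorem annWord_apply_empty_of_length_ne {N : ℕ} {ψ : Fock L.Mode}
    (hψ : ψ ∈ sector (M := L.Mode) N) (s : L.Label → Fin 2) {l : List L.Label}
    (hl : l.length ≠ N) : L.annWord s l ψ ∅ = 0 := by
  have key : ∀ l : List L.Label, (∀ k, l.length + k = N → L.annWord s l ψ ∈ sector (M := L.Mode) k) ∧
      (N < l.length → L.annWord s l ψ = 0) := by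
    intro l
    induction l with
    | nil => exact ⟨fun k hk => by simpa [annWord, ← hk] using hψ, fun h => by simp at h⟩
    | cons R l ih =>
      rw [annWord_cons, List.length_cons, Module.End.mul_apply]
      refine ⟨fun k hk => ann_mem_sector _ (ih.1 (k + 1) (by omega)), fun h => ?_⟩
      rcases Nat.lt_or_ge N l.length with h' | h'
      · rw [ih.2 h', map_zero]
      · exact ann_mem_sector_zero _ (ih.1 0 (by omega))
  rcases Nat.lt_or_ge N l.length with h | h
  · rw [(key l).2 h]; rfl
  · refine (key l).1 (N - l.length) (by omega) ∅ ?_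
    rw [Finset.card_empty]
    omega

/-- A flat-band state without singlets is determined by its amplitudes for `f` electrons: the space
spanned by the states obtained from it by annihilating `f` electrons is stable under all
annihilators. -/
theorem eq_zero_of_amp_eq_zero {N : ℕ} {ψ : Fock L.Mode} (hs : ψ ∈ sector (M := L.Mode) N)
    (hdev : ∀ o σ, L.dev K σ o ψ = 0) (hlab : ∀ R, L.labelSinglet R R ψ = 0)
    (h : ∀ A : Finset L.Label, A.card = N → ∀ s, L.amp ψ s A.toList = 0) : ψ = 0 := by
  classical
  have hcons : ∀ (x : L.Label × Fin 2) w,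
      fWord (x :: w) = L.c x.2 (Sum.inl x.1) * fWord w := fun x w => by simp [fWord]
  let V : Submodule ℂ (Fock L.Mode) := Submodule.span ℂ (Set.range fun w => fWord w ψ)
  have hf : ∀ σ R, ∀ χ ∈ V, L.c σ (Sum.inl R) χ ∈ V := by
    intro σ R χ hχ
    induction hχ using Submodule.span_induction with
    | mem χ hχ =>
      obtain ⟨w, rfl⟩ := hχ
      exact Submodule.subset_span ⟨(R, σ) :: w, by simp only [hcons, Module.End.mul_apply]⟩
    | zero => rw [map_zero]; exact V.zero_mem
    | add _ _ _ _ h1 h2 => rw [map_add]; exact V.add_mem h1 h2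
    | smul a _ _ h1 => rw [map_smul]; exact V.smul_mem a h1
  have hd : ∀ χ ∈ V, ∀ o σ, L.dev K σ o χ = 0 := by
    intro χ hχ o σ
    induction hχ using Submodule.span_induction with
    | mem χ hχ =>
      obtain ⟨w, rfl⟩ := hχ
      beta_reduce
      induction w with
      | nil => simpa [fWord] using hdev o σ
      | cons x w ih =>
        rw [hcons, ← Module.End.mul_apply, ← mul_assoc, dev_mul_c, neg_mul, LinearMap.neg_apply,
          mul_assoc, Module.End.mul_apply, Module.End.mul_apply, ih, map_zero, neg_zero]
    | zero => rw [map_zero]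
    | add _ _ _ _ h1 h2 => rw [map_add, h1, h2, add_zero]
    | smul a _ _ h1 => rw [map_smul, h1, smul_zero]
  refine eq_zero_of_ann_stable V ?_ ?_ ψ (Submodule.subset_span ⟨[], by simp [fWord]⟩)
  · rintro ⟨R | o, σ⟩ χ hχ
    · exact hf σ R χ hχ
    · change L.c σ (Sum.inr o) χ ∈ V
      rw [L.c_inr_apply (hd χ hχ)]
      exact V.sum_mem fun R _ => V.smul_mem _ (hf σ R χ hχ)
  · intro χ hχ
    induction hχ using Submodule.span_induction with
    | mem χ hχ =>
      obtain ⟨w, rfl⟩ := hχ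
      beta_reduce
      by_cases hw : (w.map Prod.fst).Nodup
      · set l := w.map Prod.fst with hl
        obtain ⟨s, hsw⟩ : ∃ s : L.Label → Fin 2, fWord w = L.annWord s l := by
          clear_value l
          induction w generalizing l with
          | nil => exact ⟨0, by simp [fWord, annWord, hl]⟩
          | cons x w ih =>
            subst hl
            obtain ⟨hx, hw⟩ := List.nodup_cons.mp hw
            obtain ⟨s, hs⟩ := ih _ hw rfl
            refine ⟨Function.update s x.1 x.2, ?_⟩
            rw [hcons, hs, List.map_cons, annWord_cons, Function.update_self]
            congr 1
            refine annWord_congr fun R hR => ?_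
            rw [Function.update_of_ne]
            rintro rfl
            exact hx hR
        rw [hsw]
        by_cases hN : l.length = N
        · have hperm : l.Perm l.toFinset.toList :=
            (List.perm_ext_iff_of_nodup hw (Finset.nodup_toList _)).mpr fun R => by simp
          obtain ⟨ε, -, hε⟩ := annWord_perm hperm
          have := h l.toFinset (by rw [List.toFinset_card_of_nodup hw, hN]) s
          rw [amp] at this
          rw [hε, LinearMap.smul_apply, PiLp.smul_apply, this, smul_zero]
        · exact annWord_apply_empty_of_length_ne hs s hN
      · have : fWord w ψ = 0 := by
          induction w with
          | nil => simp at hw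
          | cons x w ih =>
            rw [hcons, Module.End.mul_apply]
            rw [List.map_cons, List.nodup_cons, not_and_or, not_not] at hw
            rcases hw with hx | hw
            · obtain ⟨y, hy, hyx⟩ := List.mem_map.mp hx
              exact c_mul_fWord_eq_zero hlab (τ := y.2) (by rw [← hyx]; exact hy)
            · rw [ih hw, map_zero]
        rw [this]; rfl
    | zero => rfl
    | add _ _ _ _ h1 h2 => rw [PiLp.add_apply, h1, h2, add_zero]
    | smul a _ _ h1 => rw [PiLp.smul_apply, h1, smul_zero]

end Uniqueness

section Span

theorem IsGroundOn.amp_eq_zero {A B : Finset L.Label} (hcard : A.card = B.card) (hne : A ≠ B)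
    {ψ : Fock L.Mode} (h : L.IsGroundOn K A ψ) (s : L.Label → Fin 2) :
    L.amp ψ s B.toList = 0 := by
  obtain ⟨R, hR, hRA⟩ : ∃ R ∈ B, R ∉ A := by
    by_contra hn
    push Not at hn
    exact hne (Finset.eq_of_subset_of_card_le hn hcard.le).symm
  rw [amp, annWord_apply_eq_zero (Finset.mem_toList.mpr hR) (h.c_eq_zero R hRA _)]
  rfl

/-- The cluster states span the space of flat-band states without singlets on overlapping
labels. -/
theorem mem_span_clusterState (htf : 0 < K.tf) (htfp : 0 < K.tfp) {N : ℕ} {ψ : Fock L.Mode}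
    (hs : ψ ∈ sector (M := L.Mode) N) (hdev : ∀ o σ, L.dev K σ o ψ = 0)
    (hlab : ∀ R R', L.Overlap K R R' → L.labelSinglet R R' ψ = 0) :
    ψ ∈ Submodule.span ℂ {Φ : Fock L.Mode | ∃ (A : Finset L.Label) (n : Finset L.Label → ℕ),
      A.card = N ∧ (∀ C ∈ L.clusters K A, n C ≤ C.card) ∧ Φ = L.clusterState K A n} := by
  classical
  let Φ : Finset L.Label → (L.Label → Fin 2) → Fock L.Mode := fun A t =>
    L.clusterState K A (downs t)
  have hamp : ∀ (A : Finset L.Label) (t : L.Label → Fin 2), ∃ κ : ℂ, κ ≠ 0 ∧ ∀ s,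
      L.amp (Φ A t) s A.toList =
        if ∀ C ∈ L.clusters K A, downs s C = downs t C then κ else 0 := fun A t => by
    obtain ⟨κ, h0, h⟩ := hasDowns_clusterState (A := A) htf htfp (downs t)
    exact ⟨κ, h0, fun s => (h s).trans (by congr)⟩
  choose κ hκ0 hκ using hamp
  -- The number of spin configurations with the same numbers of down spins as `t`.
  let mult : Finset L.Label → (L.Label → Fin 2) → ℕ := fun A t =>
    (Finset.univ.filter fun t' : L.Label → Fin 2 =>
      ∀ C ∈ L.clusters K A, downs t C = downs t' C).card
  -- The combination of cluster states with the same amplitudes as `ψ`: each value of the numbers of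
  -- down spins is represented by all spin configurations that have it.
  let χ : Fock L.Mode := ∑ A ∈ Finset.univ.filter (fun A : Finset L.Label => A.card = N),
    ∑ t : L.Label → Fin 2, (L.amp ψ t A.toList / (κ A t * mult A t)) • Φ A t
  have hground : ∀ A t, L.IsGroundOn K A (Φ A t) := fun A t =>
    isGroundOn_clusterState htf htfp _
  have hχspan : χ ∈ Submodule.span ℂ {Φ : Fock L.Mode |
      ∃ (A : Finset L.Label) (n : Finset L.Label → ℕ),
        A.card = N ∧ (∀ C ∈ L.clusters K A, n C ≤ C.card) ∧ Φ = L.clusterState K A n} := by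
    refine Submodule.sum_mem _ fun A hA => Submodule.sum_mem _ fun t _ =>
      Submodule.smul_mem _ _ (Submodule.subset_span ⟨A, downs t, ?_, fun C _ => ?_, rfl⟩)
    · exact (Finset.mem_filter.mp hA).2
    · exact Finset.card_filter_le _ _
  have hχamp : ∀ A : Finset L.Label, A.card = N → ∀ s,
      L.amp χ s A.toList = L.amp ψ s A.toList := by
    intro A hA s
    have hlin : L.amp χ s A.toList =
        ∑ B ∈ Finset.univ.filter (fun A : Finset L.Label => A.card = N),
          ∑ t : L.Label → Fin 2,
            L.amp ψ t B.toList / (κ B t * mult B t) * L.amp (Φ B t) s A.toList := by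
      simp only [amp, χ, map_sum, map_smul, WithLp.ofLp_sum, Finset.sum_apply, PiLp.smul_apply,
        smul_eq_mul]
    rw [hlin, Finset.sum_eq_single A]
    · have hterm : ∀ t : L.Label → Fin 2,
          L.amp ψ t A.toList / (κ A t * mult A t) * L.amp (Φ A t) s A.toList =
          if ∀ C ∈ L.clusters K A, downs s C = downs t C then
            L.amp ψ s A.toList / mult A s else 0 := by
        intro t
        rw [hκ]
        split_ifs with hst
        · have hm : mult A t = mult A s := by
            refine congrArg Finset.card (Finset.filter_congr fun t' _ => ?_)
            exact forall₂_congr fun C hC => by rw [hst C hC]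
          rw [hm, amp_eq_of_downs_eq hlab hst]
          field_simp [hκ0 A t]
        · rw [mul_zero]
      rw [Finset.sum_congr rfl fun t _ => hterm t, ← Finset.sum_filter, Finset.sum_const,
        nsmul_eq_mul]
      have hpos : (mult A s : ℂ) ≠ 0 := by
        refine Nat.cast_ne_zero.mpr (Finset.card_pos.mpr ⟨s, ?_⟩).ne'
        simp
      exact mul_div_cancel₀ _ hpos
    · intro B hB hBA
      refine Finset.sum_eq_zero fun t _ => ?_
      rw [(hground B t).amp_eq_zero ((Finset.mem_filter.mp hB).2.trans hA.symm) hBA, mul_zero]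
    · intro hn
      exact absurd (Finset.mem_filter.mpr ⟨Finset.mem_univ A, hA⟩) hn
  have hχs : χ ∈ sector (M := L.Mode) N := by
    refine Submodule.sum_mem _ fun A hA => Submodule.sum_mem _ fun t _ =>
      Submodule.smul_mem _ _ ?_
    have := (hground A t).mem_sector
    rwa [(Finset.mem_filter.mp hA).2] at this
  have hχdev : ∀ o σ, L.dev K σ o χ = 0 := fun o σ => by
    simp [χ, (hground _ _).dev o σ]
  have hχlab : ∀ R, L.labelSinglet R R χ = 0 := fun R => by
    simp [χ, (hground _ _).labelSinglet R R (L.overlap_refl K htfp R)]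
  have : ψ - χ = 0 := by
    refine eq_zero_of_amp_eq_zero (K := K) (Submodule.sub_mem _ hs hχs) (fun o σ => ?_)
      (fun R => ?_) fun A hA s => ?_
    · rw [map_sub, hdev, hχdev, sub_zero]
    · rw [map_sub, hlab R R (L.overlap_refl K htfp R), hχlab, sub_zero]
    · rw [amp, map_sub, PiLp.sub_apply]
      exact sub_eq_zero.mpr (hχamp A hA s).symm
  rw [sub_eq_zero.mp this]
  exact hχspan

/-- The span of the cluster states consists of the unfrustrated states. -/
theorem mem_span_clusterState_iff (htf : 0 < K.tf) (htfp : 0 < K.tfp) {N : ℕ} (ψ : Fock L.Mode) :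
    ψ ∈ Submodule.span ℂ {Φ : Fock L.Mode | ∃ (A : Finset L.Label) (n : Finset L.Label → ℕ),
      A.card = N ∧ (∀ C ∈ L.clusters K A, n C ≤ C.card) ∧ Φ = L.clusterState K A n} ↔
    ψ ∈ sector (M := L.Mode) N ∧ L.IsUnfrustrated K ψ := by
  rw [L.isUnfrustrated_iff K htf htfp]
  refine ⟨fun h => ?_, fun h => mem_span_clusterState htf htfp h.1 h.2.1 h.2.2⟩
  induction h using Submodule.span_induction with
  | mem χ hχ =>
    obtain ⟨A, n, hA, -, rfl⟩ := hχ
    have := isGroundOn_clusterState (A := A) htf htfp n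
    exact ⟨hA ▸ this.mem_sector, this.dev, this.labelSinglet⟩
  | zero => exact ⟨Submodule.zero_mem _, fun _ _ => map_zero _, fun _ _ _ => map_zero _⟩
  | add _ _ _ _ h1 h2 =>
    exact ⟨Submodule.add_mem _ h1.1 h2.1, fun o σ => by rw [map_add, h1.2.1, h2.2.1, add_zero],
      fun R R' h => by rw [map_add, h1.2.2 R R' h, h2.2.2 R R' h, add_zero]⟩
  | smul a _ _ h1 =>
    exact ⟨Submodule.smul_mem _ _ h1.1, fun o σ => by rw [map_smul, h1.2.1, smul_zero],
      fun R R' h => by rw [map_smul, h1.2.2 R R' h, smul_zero]⟩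

theorem clusterState_ne_zero (htf : 0 < K.tf) (htfp : 0 < K.tfp) (A : Finset L.Label) :
    L.clusterState K A (fun _ => 0) ≠ 0 := by
  intro h0
  obtain ⟨κ, hκ, h⟩ := hasDowns_clusterState (A := A) htf htfp (fun _ => 0)
  have := h 0
  rw [h0, if_pos (fun C _ => by simp [downs]), amp, map_zero] at this
  exact hκ this.symm

end Span

end TwoLayer
end FlatBand

theorem theorem1 (L : FlatBand.TwoLayer) (K : FlatBand.Couplings)
    (htp : 0 < K.tp) (htf : 0 < K.tf) (htfp : 0 < K.tfp)
    (hUp : 0 < K.Up) (hUf : 0 < K.Uf) (hJ : 0 < K.J)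
    (hgap : 3 * K.tp * K.tf < K.tfp ^ 2)
    (hμ : K.μf = K.μfc + K.Uf / 2 - K.Up / 2 - K.J / 2)
    (N : ℕ) (hN : N ≤ L.Λf.card) :
    FlatBand.IsGroundStateSpace (L.Hph K) N
      (Submodule.span ℂ {Φ : FlatBand.Fock L.Mode |
        ∃ (A : Finset L.Label) (n : Finset L.Label → ℕ),
          A.card = N ∧ (∀ C ∈ L.clusters K A, n C ≤ C.card) ∧ Φ = L.clusterState K A n}) := by
  refine (L.posWithKernel_excess K htp htf hUp hUf hJ hgap).isGroundStateSpace
    (fun ψ hψ => L.Hph_apply K htf.ne' htfp.ne' hμ hψ)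
    (FlatBand.TwoLayer.mem_span_clusterState_iff htf htfp) ?_
  obtain ⟨A, -, hA⟩ := Finset.exists_subset_card_eq (s := (Finset.univ : Finset L.Label)) (n := N)
    (by rwa [Finset.card_univ, Fintype.card_coe])
  exact ⟨_, Submodule.subset_span ⟨A, fun _ => 0, hA, fun _ _ => Nat.zero_le _, rfl⟩,
    FlatBand.TwoLayer.clusterState_ne_zero htf htfp A⟩
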